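/- **Setting.** Let $n\ge 2$. For $i=1,\dots,n$ let $x_i\in\mathbb R^{d_i}$ ($d_i\ge1$) and let $f_i$ be a differentiable function of $(x_1,\dots,x_n)$. For $j=2,\dots,n$ let $T_j\ge 1$, let $x_j^{(0)}$ be a fixed vector, and let $\Phi_j^{(t)}$ ($1\le t\le T_j$) be update formulas, $x_j^{(t)}=\Phi_j^{(t)}(x_1,x_2,\dots,x_{j-1},x_j^{(t-1)})$, which may call $\nabla_{x_j}\tilde F_j$. Put $$\tilde F_i(x_1,\dots,x_i)=f_i(x_1,\dots,x_i,x_{i+1}^{(T_{i+1})},\dots,x_n^{(T_n)}),\qquad \tilde F_n=f_n,$$ where the iterates are computed successively for $j=i+1,\dots,n$, each from the last iterates of the levels above it. **Gradient algorithm** for $\nabla_{x_i}\tilde F_i$ ($i<n$): for $j=i+1,\dots,n$ set $x_j:=x_j^{(0)}$, $Z_j:=O$ and, for $t=1,\dots,T_j$, $$x_j^{(t)}:=\Phi_j^{(t)}(x_1,\dots,x_{j-1},x_j^{(t-1)}),\quad \bar B:=\sum_{i<l<j}Z_l\,\nabla_{x_l}\Phi_j^{(t)}+\nabla_{x_i}\Phi_j^{(t)},\quad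 Z_j:=Z_j\nabla_{x_j}\Phi_j^{(t)}+\bar B;$$ return $\nabla_{x_i}f_i+\sum_{j>i}Z_j\nabla_{x_j}f_i$. Here $Z_j\in\mathbb R^{d_i\times d_j}$, and the products with the transposed Jacobian matrices $\nabla\Phi_j^{(t)}$ are computed row by row, as Jacobian-vector products obtained by forward-mode automatic differentiation of the program for $\Phi_j^{(t)}$. The rows of the matrices evolve independently; for an integer $b\ge1$ the algorithm keeps $b$ rows in memory at a time and makes $\lceil d_i/b\rceil$ passes through the loops ($\nabla f_i$ is evaluated once, after the first pass). For $b\ge d_i$ this is the algorithm exactly as displayed. The program for $\nabla_{x_1}\tilde F_1$ is obtained recursively: the programs for $\Phi_j^{(t)}$ are built from the program for $\nabla_{x_j}\tilde F_j$ given by this algorithm, and for $i=n$ a program for $\nabla_{x_n}f_n$ is used. **Complexity model.** Programs are straight-line programs with procedure calls over real registers. Their elementary operations come from a library that contains constants, addition and multiplication at unit cost, and, with each operation, its partial derivatives at a cost at most $\rho$ times as large. Time is the total cost of the executed operations plus, per call, one unit and one unit per transferred argument and result; space is the peak number of memory cells, where a call takes one cell per register of its frame and one for itself. Let $c_i$,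 $s_i$ be the time and space of the program for $\nabla_{x_i}\tilde F_i$. **Assumptions**, with a constant $\kappa$: the given programs compute $\nabla_{x_j}f_i$ for $j\ge i$ and, given any program for $\nabla_{x_j}\tilde F_j$, the functions $\Phi_j^{(t)}$, everywhere and without leaving the domains of the elementary operations; evaluating $\Phi_j^{(t)}$ takes time at most $\kappa c_j$ and space at most $\kappa s_j$; for each $i<n$, evaluating all the gradients $\nabla_{x_j}f_i$, $j\ge i$, takes altogether at most $\kappa$ times the time of the loops of the gradient algorithm for $\nabla_{x_i}\tilde F_i$, and each of them takes at most $\kappa$ times the space of these loops. **Theorem.** There are a constant $K$ and $p,q>1$, depending only on $\rho$ and $\kappa$ (not on $n$, the $d_i$, the $T_j$, $b$, the functions or the programs), such that the following holds. Let $O^m(\cdot)$ denote the $m$ times nested $O(\cdot)$ with implied constant $K$ in each, i.e. $O^m(v)=K^m v$. Then $\tilde F_1$ is differentiable, the algorithm computes $\nabla_{x_1}\tilde F_1$ at every point, and $$c_1\le K\cdot O^{2n-3}(c_n)\; n!\prod_{i=1}^{n-1}T_{i+1}d_i,\qquad s_1\le b\cdot O^{2n-2}(s_n),$$ $$c_1\le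 K\, p^n c_n\; n!\prod_{i=1}^{n-1}T_{i+1}d_i,\qquad s_1\le K\, b\, q^n s_n .$$ In particular, for $b=1$ the space complexity is $O^{2n-2}(s_n)=O(q^n s_n)$; the time bounds hold for every $b$. -/

import Mathlib

/-! ### Elementary operations -/

/-- A library of elementary real operations (of at most two real arguments), as used in automatic
differentiation.  `val o` is the function that the operation `o` evaluates, `dom o` is the set of
arguments at which it may be evaluated, and `cost o` is the time of one evaluation.
The library contains the constants, addition and multiplication at unit cost, and
with an operation it contains its two partial derivatives `d1 o` and `d2 o`, which cost at most `ρ` times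
as much as the operation itself. -/
structure ElemLib (ρ : ℕ) where
  Op : Type
  val : Op → ℝ × ℝ → ℝ
  dom : Op → Set (ℝ × ℝ)
  cost : Op → ℕ
  one_le_cost : ∀ o, 1 ≤ cost o
  const : ℝ → Op
  val_const : ∀ c p, val (const c) p = c
  dom_const : ∀ c, dom (const c) = Set.univ
  cost_const : ∀ c, cost (const c) = 1
  add : Op
  val_add : ∀ p, val add p = p.1 + p.2
  dom_add : dom add = Set.univ
  cost_add : cost add = 1
  mul : Op
  val_mul : ∀ p, val mul p = p.1 * p.2
  dom_mul : dom mul = Set.univ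
  cost_mul : cost mul = 1
  d1 : Op → Op
  d2 : Op → Op
  dom_d1 : ∀ o, dom o ⊆ dom (d1 o)
  dom_d2 : ∀ o, dom o ⊆ dom (d2 o)
  cost_d1 : ∀ o, cost (d1 o) ≤ ρ * cost o
  cost_d2 : ∀ o, cost (d2 o) ≤ ρ * cost o
  hasFDerivAt : ∀ o, ∀ p ∈ dom o, HasFDerivAt (val o)
    (val (d1 o) p • ContinuousLinearMap.fst ℝ ℝ ℝ + val (d2 o) p • ContinuousLinearMap.snd ℝ ℝ ℝ) p

/-! ### The machine model: straight-line code with procedure calls -/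

/-- Straight-line code on a memory frame whose registers (each holds one real number) are
indexed by `ι`.
* `op o dst a b` stores the value of the operation `o` at the registers `a`, `b` in `dst`;
* `call inp body out args dst` creates a fresh frame `κ`, filled with zeros, copies
  the registers `args` to its registers `inp`, runs `body` on it, copies its registers `out` to
  the registers `dst` of the caller and releases the frame. -/
inductive Code {ρ : ℕ} (L : ElemLib ρ) : Type → Type 1
  | skip {ι : Type} : Code L ι
  | op {ι : Type} (o : L.Op) (dst a b : ι) : Code L ι
  | seq {ι : Type} (c₁ c₂ : Code L ι) : Code L ι
  | call {ι κ α β : Type} [Fintype κ] [Fintype α] [Fintype β] (inp : α ↪ κ) (body : Code L κ)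
      (out : β → κ) (args : α → ι) (dst : β ↪ ι) : Code L ι

namespace Code

variable {ρ : ℕ} {L : ElemLib ρ}

open Classical in
/-- The effect of a code on the contents of a frame. -/
noncomputable def run : {ι : Type} → Code L ι → (ι → ℝ) → (ι → ℝ)
  | _, skip, σ => σ
  | _, op o dst a b, σ => Function.update σ dst (L.val o (σ a, σ b))
  | _, seq c₁ c₂, σ => c₂.run (c₁.run σ)
  | _, call inp body out args dst, σ =>
      Function.extend dst (body.run (Function.extend inp (σ ∘ args) 0) ∘ out) σ

/-- Every elementary operation that is executed gets arguments in its domain. -/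
noncomputable def Safe : {ι : Type} → Code L ι → (ι → ℝ) → Prop
  | _, skip, _ => True
  | _, op o _ a b, σ => (σ a, σ b) ∈ L.dom o
  | _, seq c₁ c₂, σ => c₁.Safe σ ∧ c₂.Safe (c₁.run σ)
  | _, call inp body _ args _, σ => body.Safe (Function.extend inp (σ ∘ args) 0)

/-- Running time: the total cost of the executed operations; a call costs one unit, plus one unit
per transferred argument and result, plus the running time of its body. -/
def time : {ι : Type} → Code L ι → ℕ
  | _, skip => 0
  | _, op o _ _ _ => L.cost o
  | _, seq c₁ c₂ => c₁.time + c₂.time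
  | _, @call _ _ _ _ α β _ _ _ _ body _ _ _ =>
      1 + Fintype.card α + body.time + Fintype.card β

/-- Peak number of memory cells in use beyond the current frame; the frame of a call takes
one cell per register and one cell for the call itself. -/
def space : {ι : Type} → Code L ι → ℕ
  | _, skip => 0
  | _, op _ _ _ _ => 0
  | _, seq c₁ c₂ => max c₁.space c₂.space
  | _, @call _ _ _ κ _ _ _ _ _ _ body _ _ _ => Fintype.card κ + 1 + body.space

/-- Sequential execution of a list of codes (loops are unrolled). -/
def seqs {ι : Type} (l : List (Code L ι)) : Code L ι := l.foldr seq skip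

/-- The frame of the differentiated code: `Sum.inl r` holds the value of the register `r`,
`Sum.inr (Sum.inl r)` its tangent; there are two scratch registers. -/
abbrev Dual (ι : Type) : Type := ι ⊕ (ι ⊕ Fin 2)

/-- Pairs of values and tangents, as an embedding into the dual frame. -/
def dualEmb {α ι : Type} (e : α ↪ ι) : α ⊕ α ↪ Dual ι :=
  e.sumMap (e.trans Function.Embedding.inl)

/-- Pairs of values and tangents, as a map into the dual frame. -/
def dualMap {α ι : Type} (e : α → ι) : α ⊕ α → Dual ι :=
  Sum.map e (Sum.inl ∘ e)

/-- Forward-mode automatic differentiation of a code. -/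
def jvp : {ι : Type} → Code L ι → Code L (Dual ι)
  | _, skip => skip
  | ι, op o dst a b =>
      let pr : ι → Dual ι := Sum.inl
      let tg : ι → Dual ι := Sum.inr ∘ Sum.inl
      let t₀ : Dual ι := Sum.inr (Sum.inr 0)
      let t₁ : Dual ι := Sum.inr (Sum.inr 1)
      seqs [op (L.d1 o) t₀ (pr a) (pr b), op L.mul t₀ t₀ (tg a),
        op (L.d2 o) t₁ (pr a) (pr b), op L.mul t₁ t₁ (tg b),
        op L.add (tg dst) t₀ t₁, op o (pr dst) (pr a) (pr b)]
  | _, seq c₁ c₂ => seq c₁.jvp c₂.jvp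
  | _, call inp body out args dst =>
      call (dualEmb inp) body.jvp (dualMap out) (dualMap args) (dualEmb dst)

end Code

/-- A procedure with input `α → ℝ` and output `β → ℝ`: a frame, a code on it, and the registers of the
frame that hold the input at the start and the output at the end. -/
structure Proc {ρ : ℕ} (L : ElemLib ρ) (α β : Type) where
  Frame : Type
  [fintypeFrame : Fintype Frame]
  inp : α ↪ Frame
  body : Code L Frame
  out : β → Frame

attribute [instance] Proc.fintypeFrame

namespace Proc

variable {ρ : ℕ} {L : ElemLib ρ} {α β : Type}

/-- The function computed by a procedure. -/
noncomputable def eval (P : Proc L α β) (x : α → ℝ) : β → ℝ :=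
  P.body.run (Function.extend P.inp x 0) ∘ P.out

/-- The procedure `P` computes the function `F` (on all inputs, and without ever leaving the
domain of an elementary operation). -/
def Computes (P : Proc L α β) (F : (α → ℝ) → (β → ℝ)) : Prop :=
  ∀ x, P.body.Safe (Function.extend P.inp x 0) ∧ P.eval x = F x

/-- Calling a procedure from another frame. -/
def call [Fintype α] [Fintype β] {ι : Type} (P : Proc L α β) (args : α → ι) (dst : β ↪ ι) :
    Code L ι :=
  Code.call P.inp P.body P.out args dst

/-- Time complexity of a procedure: the time of one call. -/
def time [Fintype α] [Fintype β] (P : Proc L α β) : ℕ :=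
  1 + Fintype.card α + P.body.time + Fintype.card β

/-- Space complexity of a procedure: the memory that one call needs. -/
def space (P : Proc L α β) : ℕ := Fintype.card P.Frame + 1 + P.body.space

/-- The procedure that maps a point and a direction to the value of `P` at the point and the
product of the Jacobian matrix of `P` with the direction. -/
def jvp (P : Proc L α β) : Proc L (α ⊕ α) (β ⊕ β) where
  Frame := Code.Dual P.Frame
  inp := Code.dualEmb P.inp
  body := P.body.jvp
  out := Code.dualMap P.out

/-- Renaming of the input coordinates. -/
def reindex {α' : Type} (e : α' ≃ α) (P : Proc L α β) : Proc L α' β where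
  Frame := P.Frame
  inp := e.toEmbedding.trans P.inp
  body := P.body
  out := P.out

end Proc

/-! ### Multilevel problems with approximated lower levels -/

/-- Coordinates of the collection of all decision variables: `⟨j, a⟩` is the `a`-th coordinate
of the variable of level `j`. -/
abbrev Coord {N : ℕ} (d : Fin (N + 1) → ℕ) : Type := (j : Fin (N + 1)) × Fin (d j)

/-- Coordinates of the variables of the levels up to `i`. -/
abbrev CoordLE {N : ℕ} (d : Fin (N + 1) → ℕ) (i : Fin (N + 1)) : Type :=
  {v : Coord d // v.1 ≤ i}

/-- The levels below level `i` (those with a larger index), in increasing order. -/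
def lowerLevels {N : ℕ} (i : Fin (N + 1)) : List {j : Fin (N + 1) // i < j} :=
  (List.finRange (N + 1)).filterMap fun j => if h : i < j then some ⟨j, h⟩ else none

/-- A multilevel problem with `n = N + 1` levels in which each lower-level problem is replaced by
finitely many steps of an iterative method.  Level `0` is the top level, level `N` is the
lowest one.  Level `i` has the variable `x_i ∈ ℝ^(d i)` and the objective function `f i` of all variables.
At each level `j > 0` there are `T j` iterations from the initial point `x0`, and
`Φ j t` (`1 ≤ t ≤ T j`) is the update formula
`x_j^(t) = Φ j t (x_0, …, x_{j-1}, x_j^(t-1))`. -/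
structure MultilevelProblem (N : ℕ) where
  d : Fin (N + 1) → ℕ
  f : Fin (N + 1) → (Coord d → ℝ) → ℝ
  T : Fin (N + 1) → ℕ
  Φ : (j : Fin (N + 1)) → ℕ → (CoordLE d j → ℝ) → (Fin (d j) → ℝ)
  x0 : Coord d → ℝ

namespace MultilevelProblem

variable {N : ℕ} (P : MultilevelProblem N)

/-- Replace the variable of level `j` in `x` by `y`. -/
noncomputable def setBlock (x : Coord P.d → ℝ) (j : Fin (N + 1)) (y : Fin (P.d j) → ℝ) :
    Coord P.d → ℝ :=
  Function.extend (Sigma.mk j) y x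

/-- Replace the variable of level `j` by the last iterate `x_j^(T_j)` of its iterative method, run
with the variables of the levels above `j` given by `x`. -/
noncomputable def solveLevel (x : Coord P.d → ℝ) (j : Fin (N + 1)) : Coord P.d → ℝ :=
  (List.range (P.T j)).foldl (fun x t => P.setBlock x j (P.Φ j (t + 1) fun v => x v.1))
    (P.setBlock x j fun a => P.x0 ⟨j, a⟩)

/-- The approximated objective function of level `i`, a function of `x_0, …, x_i`:
`F̃_i(x_0, …, x_i) = f_i(x_0, …, x_i, x_{i+1}^(T_{i+1}), …, x_N^(T_N))`. -/
noncomputable def Ftilde (i : Fin (N + 1)) (x : CoordLE P.d i → ℝ) : ℝ :=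
  P.f i ((lowerLevels i).foldl (fun x j => P.solveLevel x j.1) (Function.extend Subtype.val x 0))

/-- The gradient of `f i` with respect to the variable of level `j`. -/
noncomputable def gradf (i j : Fin (N + 1)) (x : Coord P.d → ℝ) (a : Fin (P.d j)) : ℝ :=
  fderiv ℝ (P.f i) x (Pi.single ⟨j, a⟩ 1)

/-- The gradient of `F̃_i` with respect to the variable of level `i`. -/
noncomputable def gradF (i : Fin (N + 1)) (x : CoordLE P.d i → ℝ) (a : Fin (P.d i)) : ℝ :=
  fderiv ℝ (P.Ftilde i) x (Pi.single ⟨⟨i, a⟩, le_rfl⟩ 1)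

end MultilevelProblem

/-! ### The gradient algorithm -/

/-- Names of the vectors (one entry for each coordinate) in the memory of the gradient algorithm:
`x` holds the variables, `z r` holds the row in slot `r` of the matrices `Z_j`, `bbar` holds a row of
the matrix `B̄_j`, `grad` holds the gradients of `f_i`, and `y`, `w` receive results of
Jacobian-vector products. -/
inductive Slot (b : ℕ) : Type
  | x | y | w | bbar | grad
  | z (r : Fin b)
  deriving DecidableEq, Fintype

/-- Registers of the gradient algorithm for level `i`: the vectors above, the result `g`,
the constants zero and one, and one scratch register. -/
abbrev Reg {N : ℕ} (d : Fin (N + 1) → ℕ) (b : ℕ) (i : Fin (N + 1)) : Type :=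
  (Slot b × Coord d) ⊕ (Fin (d i) ⊕ Fin 3)

namespace Reg

variable {N : ℕ} {d : Fin (N + 1) → ℕ} {b : ℕ} {i : Fin (N + 1)}

/-- The entry of the vector `s` at the coordinate `v`. -/
def vec (s : Slot b) (v : Coord d) : Reg d b i := Sum.inl (s, v)

/-- The `k`-th entry of the result. -/
def g (k : Fin (d i)) : Reg d b i := Sum.inr (Sum.inl k)

/-- A register that always holds the number zero. -/
def zero : Reg d b i := Sum.inr (Sum.inr 0)

/-- A register that holds the number one. -/
def one : Reg d b i := Sum.inr (Sum.inr 1)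

/-- A scratch register. -/
def tmp : Reg d b i := Sum.inr (Sum.inr 2)

/-- The block of level `j` of the vector `s`, as a destination. -/
def block (s : Slot b) (j : Fin (N + 1)) : Fin (d j) ↪ Reg d b i where
  toFun a := vec s ⟨j, a⟩
  inj' a a' h := by simpa [vec] using h

/-- The block of level `j` of `y` for the value and of `s ≠ y` for the tangent. -/
def blocks (s : Slot b) (hs : s ≠ Slot.y) (j : Fin (N + 1)) : Fin (d j) ⊕ Fin (d j) ↪ Reg d b i where
  toFun := Sum.elim (fun a => vec Slot.y ⟨j, a⟩) (fun a => vec s ⟨j, a⟩)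
  inj' := by
    rintro (a | a) (a' | a') h
    · simpa [vec] using h
    · simp [vec] at h; exact absurd h.1.symm hs
    · simp [vec] at h; exact absurd h.1 hs
    · simpa [vec] using h

/-- The input variables, as registers. -/
def input (i : Fin (N + 1)) : CoordLE d i ↪ Reg d b i where
  toFun v := vec Slot.x v.1
  inj' v v' h := by
    apply Subtype.ext
    simpa [vec] using h

end Reg

/-- The programs from which the gradient algorithm is assembled: `gradf i j` for the
gradient of `f i` with respect to the variable of level `j`, and `upd j t`, which makes from a procedure
for the gradient of `F̃_j` (to be called as a subroutine) a procedure for the update formula `Φ j t`. -/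
structure Programs {ρ : ℕ} (L : ElemLib ρ) {N : ℕ} (d : Fin (N + 1) → ℕ) where
  gradf : (i j : Fin (N + 1)) → Proc L (Coord d) (Fin (d j))
  upd : (j : Fin (N + 1)) → ℕ → Proc L (CoordLE d j) (Fin (d j)) → Proc L (CoordLE d j) (Fin (d j))

/-- The gradient algorithm for level `i`,
```
for j = i+1, …, N:
  x_j := x_j^(0);  Z_j := 0
  for t = 1, …, T_j:
    x_j^(t) := Φ_j^(t)(x_0, …, x_{j-1}, x_j^(t-1))
    B̄ := ∑_{i<l<j} Z_l C_{jl} + B_j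
    Z_j := Z_j A_j + B̄
g := ∇_{x_i} f_i + ∑_{j>i} Z_j ∇_{x_j} f_i
```
where `A_j`, `C_{jl}`, `B_j` are the transposed Jacobian matrices of `Φ_j^(t)` with respect to
`x_j`, `x_l`, `x_i` at `(x_0, …, x_{j-1}, x_j^(t-1))`; products with them are computed row by row as
Jacobian-vector products.  The rows of the matrices `Z_j ∈ ℝ^(d_i × d_j)` evolve independently
of each other.  At most `b` of them are kept in memory: they are processed in passes of `b` rows.
If `b ≥ d_i`, then there is a single pass, which is the algorithm displayed above. -/
structure GradAlgo {ρ : ℕ} (L : ElemLib ρ) {N : ℕ} (P : MultilevelProblem N) (b : ℕ)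
    (i : Fin (N + 1)) where
  /-- procedures for the update formulas of the lower levels -/
  phi : (j : {j : Fin (N + 1) // i < j}) → ℕ → Proc L (CoordLE P.d j.1) (Fin (P.d j.1))
  /-- procedures for the gradients of `f_i` -/
  gradf : (j : Fin (N + 1)) → Proc L (Coord P.d) (Fin (P.d j))

namespace GradAlgo

open Code

variable {ρ : ℕ} {L : ElemLib ρ} {N : ℕ} {P : MultilevelProblem N} {b : ℕ} [NeZero b]
  {i : Fin (N + 1)} (A : GradAlgo L P b i)

/-- The rows `k` that are processed in pass number `p`. -/
def rows (b : ℕ) {m : ℕ} (p : ℕ) : List (Fin m) :=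
  (List.finRange m).filter fun k => k.val / b = p

/-- The vector that holds row `k` of the matrices `Z_j` while it is processed. -/
def row {m : ℕ} (k : Fin m) : Slot b := Slot.z (Fin.ofNat b k.val)

/-- Jacobian-vector product of `Φ_j^(t)` at the current point; the registers `dir` hold the
direction, and the product is written to the vector `s`. -/
def product (j : {j : Fin (N + 1) // i < j}) (t : ℕ) (dir : Coord P.d → Reg P.d b i)
    (s : Slot b) (hs : s ≠ Slot.y) : Code L (Reg P.d b i) :=
  (A.phi j t).jvp.call (Sum.elim (fun v => Reg.vec Slot.x v.1) (fun v => dir v.1))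
    (Reg.blocks s hs j.1)

/-- The direction given by the block of level `l` of row `k`. -/
def rowDir (k : Fin (P.d i)) (l : Fin (N + 1)) (v : Coord P.d) : Reg P.d b i :=
  if v.1 = l then Reg.vec (row k) v else Reg.zero

open Classical in
/-- The direction of the `k`-th coordinate of `x_i`. -/
noncomputable def unitDir (k : Fin (P.d i)) (v : Coord P.d) : Reg P.d b i :=
  if v = ⟨i, k⟩ then Reg.one else Reg.zero

/-- `x_j := x_j^(0)`, and `Z_j := 0` for the rows of pass `p`. -/
def init (p : ℕ) (j : {j : Fin (N + 1) // i < j}) : Code L (Reg P.d b i) :=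
  seqs ((List.finRange (P.d j.1)).map fun a =>
    seq (op (L.const (P.x0 ⟨j.1, a⟩)) (Reg.vec Slot.x ⟨j.1, a⟩) Reg.zero Reg.zero)
      (seqs ((rows b p).map fun k : Fin (P.d i) =>
        op (L.const 0) (Reg.vec (row k) ⟨j.1, a⟩) Reg.zero Reg.zero)))

/-- Row `k` of `B̄ := ∑_{i<l<j} Z_l C_{jl} + B_j` and of `Z_j := Z_j A_j + B̄`. -/
noncomputable def updateRow (j : {j : Fin (N + 1) // i < j}) (t : ℕ) (k : Fin (P.d i)) :
    Code L (Reg P.d b i) :=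
  seqs [A.product j t (unitDir k) Slot.bbar (by simp),
    seqs (((lowerLevels i).filter fun l => l < j).map fun l =>
      seq (A.product j t (rowDir k l.1) Slot.w (by simp))
        (seqs ((List.finRange (P.d j.1)).map fun a =>
          op L.add (Reg.vec Slot.bbar ⟨j.1, a⟩) (Reg.vec Slot.bbar ⟨j.1, a⟩)
            (Reg.vec Slot.w ⟨j.1, a⟩)))),
    A.product j t (rowDir k j.1) Slot.w (by simp),
    seqs ((List.finRange (P.d j.1)).map fun a =>
      op L.add (Reg.vec (row k) ⟨j.1, a⟩) (Reg.vec Slot.w ⟨j.1, a⟩)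
        (Reg.vec Slot.bbar ⟨j.1, a⟩))]

/-- One iteration of the inner loop.  The Jacobian matrices are taken at `x_j^(t-1)`, so this
iterate is overwritten last. -/
noncomputable def step (p : ℕ) (j : {j : Fin (N + 1) // i < j}) (t : ℕ) : Code L (Reg P.d b i) :=
  seq (seqs ((rows b p).map fun k => A.updateRow j t k))
    ((A.phi j t).call (fun v => Reg.vec Slot.x v.1) (Reg.block Slot.x j.1))

/-- The nested loops over `j` and `t`, for the rows of pass `p`. -/
noncomputable def loopPass (p : ℕ) : Code L (Reg P.d b i) :=
  seqs ((lowerLevels i).map fun j =>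
    seq (init p j) (seqs ((List.range (P.T j.1)).map fun t => A.step p j (t + 1))))

/-- The gradients of `f_i` with respect to `x_i, …, x_N` at the current point. -/
def gradients : Code L (Reg P.d b i) :=
  seqs ((i :: (lowerLevels i).map Subtype.val).map fun j =>
    (A.gradf j).call (Reg.vec Slot.x) (Reg.block Slot.grad j))

/-- The entries of `g := ∇_{x_i} f_i + ∑_{j>i} Z_j ∇_{x_j} f_i` for the rows of pass `p`. -/
def finish (p : ℕ) : Code L (Reg P.d b i) :=
  seqs ((rows b p).map fun k : Fin (P.d i) =>
    seq (op L.add (Reg.g k) (Reg.vec Slot.grad ⟨i, k⟩) Reg.zero)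
      (seqs ((lowerLevels i).map fun j => seqs ((List.finRange (P.d j.1)).map fun a =>
        seq (op L.mul Reg.tmp (Reg.vec (row k) ⟨j.1, a⟩) (Reg.vec Slot.grad ⟨j.1, a⟩))
          (op L.add (Reg.g k) (Reg.g k) Reg.tmp)))))

/-- Number of the passes after the first one; there are `⌈d_i / b⌉` passes. -/
def morePasses (_ : GradAlgo L P b i) : ℕ := (P.d i - 1) / b

/-- All executions of the nested loops. -/
noncomputable def loops : Code L (Reg P.d b i) :=
  seqs ((List.range (A.morePasses + 1)).map fun p => A.loopPass p)

/-- The gradient algorithm.  The gradients of `f_i` are evaluated once, after the first pass. -/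
noncomputable def toProc : Proc L (CoordLE P.d i) (Fin (P.d i)) where
  Frame := Reg P.d b i
  inp := Reg.input i
  body := seqs [op (L.const 1) Reg.one Reg.zero Reg.zero,
    A.loopPass 0, A.gradients, finish 0,
    seqs ((List.range A.morePasses).map fun p => seq (A.loopPass (p + 1)) (finish (p + 1)))]
  out := Reg.g

/-- Time of the loops. -/
noncomputable def loopTime : ℕ := A.loops.time

/-- Space of the loops, including the variables of the algorithm. -/
noncomputable def loopSpace : ℕ := Fintype.card (Reg P.d b i) + 1 + A.loops.space

end GradAlgo

namespace Programs

variable {ρ : ℕ} {L : ElemLib ρ} {N : ℕ} {P : MultilevelProblem N}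

/-- The procedure for the gradient of `F̃_i` with respect to the variable of level `i`, obtained by
recursively calling the gradient algorithm: at the lowest level `F̃_N = f_N`; at a higher
level the gradient algorithm runs with the update procedures of the lower levels, which call
the gradient procedures of these levels. -/
noncomputable def gradProc (I : Programs L P.d) (b : ℕ) [NeZero b] (i : Fin (N + 1)) :
    Proc L (CoordLE P.d i) (Fin (P.d i)) :=
  if h : i = Fin.last N then
    (I.gradf i i).reindex (Equiv.subtypeUnivEquiv fun v => h ▸ Fin.le_last v.1)
  else
    GradAlgo.toProc (P := P) (b := b)
      { phi := fun j t => I.upd j.1 t (gradProc I b j.1)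
        gradf := I.gradf i }
  termination_by N - i.val
  decreasing_by have := j.2; have := j.1.isLt; omega

/-- The procedure for the update formula `Φ j t`. -/
noncomputable def phi (I : Programs L P.d) (b : ℕ) [NeZero b] (j : Fin (N + 1)) (t : ℕ) :
    Proc L (CoordLE P.d j) (Fin (P.d j)) :=
  I.upd j t (I.gradProc b j)

/-- The run of the gradient algorithm at level `i`. -/
noncomputable def algo (I : Programs L P.d) (b : ℕ) [NeZero b] (i : Fin (N + 1)) :
    GradAlgo L P b i where
  phi j t := I.phi b j.1 t
  gradf := I.gradf i

end Programs

/-- The `m` times nested `O(O(⋯O(v)⋯))`, with the implied constant `K` in each `O`. -/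
def nestedO (K m v : ℕ) : ℕ := (fun u => K * u)^[m] v

/-! Correctness. The loops are forward-mode differentiation along a trajectory. For fixed `i`, let
`X x` be the vector of all variables after some of the iterations, as a function of the variables
`x` of the levels up to `i`. The invariant (`GradAlgo.Holds`) says that the registers hold `X x₀`
and that row `k` of `Z_j` is block `j` of the derivative of `X` in the direction of the `k`-th
coordinate of `x_i`. An iteration replaces one block of `X` by `Φ_j` of the blocks up to `j`. By the
chain rule the corresponding block of the derivative becomes the Jacobian of `Φ_j` applied to the
direction composed of the unit vector and the rows of `Z_l`, `i < l ≤ j`. Linearity splits this into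
the products that the algorithm forms (`updateRow_spec`, `step_holds`, `loopPass_holds`). The
returned vector is the chain rule for `f_i ∘ X` (`gradF_eq`).

No differentiability of `Φ_j` is assumed. Straight-line code that never leaves the domains of its
operations computes a differentiable function, and one induction over the code gives this together
with the correctness of its differentiated version (`Code.jvp_spec`, `Proc.Computes.jvp`).
Differentiation passes through procedure calls, so the gradient programs called inside `Φ_j` are
differentiated as well. Induction from the lowest level upwards then gives all levels.

Time. Differentiation multiplies time by at most `2ρ + 4`, and a row at level `j` needs at most `j -
i + 1` products. Each row occurs in one pass and there are at most `d_i` passes, so, independently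
of `b`, `c_i ≤ C d_i ∑_{j>i} T_j (j - i + 1) c_j` with `C` depending only on `ρ` and `κ`. In the
solution of this recursion the weights `j - i + 1` build up the factorial, the factors `d` and `T`
build up the product, and a geometric sum with ratio above `C` absorbs the sum over `j`
(`gradProc_time_le`).

Space. Differentiation multiplies space by at most 3, and consecutive calls reuse memory. Only the
algorithm's own frame grows with `b`; the space of the called procedures is multiplied by a
constant. Hence `b` enters the bound once and not once per level (`gradProc_space_le`). -/

namespace Code

variable {ρ : ℕ} {L : ElemLib ρ} {ι : Type}

/-! ### Automatic differentiation -/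

/-- The dual state `τ` holds the point `σ` and the tangent `u`. -/
def Carries (τ : Dual ι → ℝ) (σ u : ι → ℝ) : Prop :=
  (∀ r, τ (Sum.inl r) = σ r) ∧ ∀ r, τ (Sum.inr (Sum.inl r)) = u r

-- The value register is overwritten last and the tangent register just before it, so the partial
-- derivatives and old tangents are read at the old point even if `dst` coincides with `a` or `b`.
open Classical in
theorem op_jvp_run {o : L.Op} {dst a b : ι} {τ : Dual ι → ℝ} {σ u : ι → ℝ} (h : Carries τ σ u) :
    Carries ((op o dst a b).jvp.run τ) ((op o dst a b).run σ)
      (Function.update u dst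
        (L.val (L.d1 o) (σ a, σ b) * u a + L.val (L.d2 o) (σ a, σ b) * u b)) := by
  obtain ⟨h1, h2⟩ := h
  constructor
  · intro r
    by_cases hr : r = dst
    · subst hr
      simp [jvp, seqs, run, h1]
    · simp [jvp, seqs, run, h1, hr]
  · intro r
    by_cases hr : r = dst
    · subst hr
      simp [jvp, seqs, run, h1, h2, L.val_mul, L.val_add]
    · simp [jvp, seqs, run, h2, hr]

theorem op_jvp_safe {o : L.Op} {dst a b : ι} {τ : Dual ι → ℝ} {σ u : ι → ℝ} (h : Carries τ σ u)
    (hs : (op o dst a b).Safe σ) : (op o dst a b).jvp.Safe τ := by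
  classical
  have hs' : (σ a, σ b) ∈ L.dom o := hs
  simp [jvp, seqs, run, Safe, h.1, L.dom_mul, L.dom_add,
    L.dom_d1 o hs', L.dom_d2 o hs', hs']

/-- The zero filling of a fresh frame is constant, so its tangent is zero: filling the dual frame
with zeros is the right start for a differentiated call. -/
theorem extend_dualEmb {α κ : Type} (e : α ↪ κ) (x : α ⊕ α → ℝ) :
    Carries (Function.extend (dualEmb e) x 0) (Function.extend e (x ∘ Sum.inl) 0)
      (Function.extend e (x ∘ Sum.inr) 0) := by
  constructor
  · intro r
    by_cases hr : ∃ a, e a = r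
    · obtain ⟨a, rfl⟩ := hr
      rw [e.injective.extend_apply]
      exact (dualEmb e).injective.extend_apply x 0 (Sum.inl a)
    · rw [Function.extend_apply' _ _ _ hr, Function.extend_apply']
      · rfl
      · rintro ⟨a | a, h⟩
        · exact hr ⟨a, by simpa [dualEmb] using h⟩
        · simp [dualEmb] at h
  · intro r
    by_cases hr : ∃ a, e a = r
    · obtain ⟨a, rfl⟩ := hr
      rw [e.injective.extend_apply]
      exact (dualEmb e).injective.extend_apply x 0 (Sum.inr a)
    · rw [Function.extend_apply' _ _ _ hr, Function.extend_apply']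
      · rfl
      · rintro ⟨a | a, h⟩
        · simp [dualEmb] at h
        · exact hr ⟨a, by simpa [dualEmb] using h⟩

theorem Carries.extend {β : Type} {τ : Dual ι → ℝ} {σ u : ι → ℝ} (h : Carries τ σ u) (e : β ↪ ι)
    (y : β ⊕ β → ℝ) :
    Carries (Function.extend (dualEmb e) y τ) (Function.extend e (y ∘ Sum.inl) σ)
      (Function.extend e (y ∘ Sum.inr) u) := by
  constructor
  · intro r
    by_cases hr : ∃ a, e a = r
    · obtain ⟨a, rfl⟩ := hr
      rw [e.injective.extend_apply]
      exact (dualEmb e).injective.extend_apply y τ (Sum.inl a)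
    · rw [Function.extend_apply' _ _ _ hr, Function.extend_apply']
      · exact h.1 r
      · rintro ⟨a | a, h⟩
        · exact hr ⟨a, by simpa [dualEmb] using h⟩
        · simp [dualEmb] at h
  · intro r
    by_cases hr : ∃ a, e a = r
    · obtain ⟨a, rfl⟩ := hr
      rw [e.injective.extend_apply]
      exact (dualEmb e).injective.extend_apply y τ (Sum.inr a)
    · rw [Function.extend_apply' _ _ _ hr, Function.extend_apply']
      · exact h.2 r
      · rintro ⟨a | a, h⟩
        · simp [dualEmb] at h
        · exact hr ⟨a, by simpa [dualEmb] using h⟩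

/-- A function that is extended by zero has the derivative that is extended by zero. -/
theorem hasFDerivAt_extend {E : Type} [NormedAddCommGroup E] [NormedSpace ℝ E] {α κ : Type}
    (e : α ↪ κ) {x : E → α → ℝ} {y : E → κ → ℝ} {x' : α → E →L[ℝ] ℝ} {y' : κ → E →L[ℝ] ℝ} {x₀ : E}
    (hx : ∀ a, HasFDerivAt (fun p => x p a) (x' a) x₀)
    (hy : ∀ r, HasFDerivAt (fun p => y p r) (y' r) x₀) (r : κ) :
    HasFDerivAt (fun p => Function.extend e (x p) (y p) r) (Function.extend e x' y' r) x₀ := by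
  by_cases hr : ∃ a, e a = r
  · obtain ⟨a, rfl⟩ := hr
    simpa only [e.injective.extend_apply] using hx a
  · simpa only [Function.extend_apply' _ _ _ hr] using hy r

theorem extend_clm_apply {E : Type} [NormedAddCommGroup E] [NormedSpace ℝ E] {α κ : Type}
    (e : α ↪ κ) (x' : α → E →L[ℝ] ℝ) (y' : κ → E →L[ℝ] ℝ) (v : E) (r : κ) :
    Function.extend e x' y' r v = Function.extend e (fun a => x' a v) (fun r => y' r v) r := by
  by_cases hr : ∃ a, e a = r
  · obtain ⟨a, rfl⟩ := hr
    simp only [e.injective.extend_apply]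
  · simp only [Function.extend_apply' _ _ _ hr]

/-- Forward-mode differentiation is correct: a code that runs safely is differentiable, and its
differentiated code propagates tangents by the derivative. -/
theorem jvp_spec {E : Type} [NormedAddCommGroup E] [NormedSpace ℝ E] (c : Code L ι)
    (σ : E → ι → ℝ) (σ' : ι → E →L[ℝ] ℝ) (x₀ : E)
    (hσ : ∀ r, HasFDerivAt (fun x => σ x r) (σ' r) x₀) (hs : c.Safe (σ x₀)) :
    ∃ D : ι → E →L[ℝ] ℝ, (∀ r, HasFDerivAt (fun x => c.run (σ x) r) (D r) x₀) ∧
      ∀ (v : E) (τ : Dual ι → ℝ), Carries τ (σ x₀) (fun r => σ' r v) →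
        c.jvp.Safe τ ∧ Carries (c.jvp.run τ) (c.run (σ x₀)) (fun r => D r v) := by
  classical
  induction c with
  | skip => exact ⟨σ', hσ, fun v τ h => ⟨trivial, h⟩⟩
  | @op ι o dst a b =>
    have ho := L.hasFDerivAt o _ hs
    refine ⟨Function.update σ' dst
      (L.val (L.d1 o) (σ x₀ a, σ x₀ b) • σ' a + L.val (L.d2 o) (σ x₀ a, σ x₀ b) • σ' b), ?_, ?_⟩
    · intro r
      by_cases hr : r = dst
      · subst hr
        have h := ho.comp x₀ ((hσ a).prodMk (hσ b))
        simp only [run, Function.update_self]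
        refine h.congr_fderiv ?_
        ext v
        simp
      · simpa only [run, Function.update_of_ne hr] using hσ r
    · intro v τ h
      refine ⟨op_jvp_safe h hs, ?_⟩
      convert op_jvp_run h using 1
      funext r
      by_cases hr : r = dst
      · subst hr; simp
      · simp [Function.update_of_ne hr]
  | seq c₁ c₂ ih₁ ih₂ =>
    obtain ⟨D₁, hD₁, H₁⟩ := ih₁ σ σ' hσ hs.1
    obtain ⟨D₂, hD₂, H₂⟩ := ih₂ (fun x => c₁.run (σ x)) D₁ hD₁ hs.2
    exact ⟨D₂, hD₂, fun v τ h => ⟨⟨(H₁ v τ h).1, (H₂ v _ (H₁ v τ h).2).1⟩,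
      (H₂ v _ (H₁ v τ h).2).2⟩⟩
  | call inp body out args dst ih =>
    -- The state is a function of an external parameter in `E` for the sake of this case: the frame
    -- changes at a call, but the callee's initial state is again a differentiable function of the
    -- same parameter.
    obtain ⟨D, hD, H⟩ := ih (fun x => Function.extend inp (σ x ∘ args) 0)
      (Function.extend inp (σ' ∘ args) 0)
      (hasFDerivAt_extend inp (fun a => hσ (args a)) fun r => hasFDerivAt_const 0 x₀) hs
    refine ⟨Function.extend dst (D ∘ out) σ',
      hasFDerivAt_extend dst (fun a => hD (out a)) hσ, fun v τ h => ?_⟩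
    have hc : Carries (Function.extend (dualEmb inp) (τ ∘ dualMap args) 0)
        (Function.extend inp (σ x₀ ∘ args) 0)
        (fun r => Function.extend inp (σ' ∘ args) 0 r v) := by
      convert extend_dualEmb inp (τ ∘ dualMap args) using 1
      · congr 1
        funext a
        simp [dualMap, h.1]
      · funext r
        rw [extend_clm_apply]
        congr 1
        funext a
        simp [dualMap, h.2]
    obtain ⟨hsafe, hrun⟩ := H v _ hc
    refine ⟨hsafe, ?_⟩
    change Carries (Function.extend (dualEmb dst) (body.jvp.run (Function.extend (dualEmb inp)
      (τ ∘ dualMap args) 0) ∘ dualMap out) τ) (Function.extend dst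
        (body.run (Function.extend inp (σ x₀ ∘ args) 0) ∘ out) (σ x₀)) _
    convert h.extend dst (body.jvp.run (Function.extend (dualEmb inp) (τ ∘ dualMap args) 0) ∘
      dualMap out) using 1
    · congr 1
      funext a
      exact (hrun.1 (out a)).symm
    · funext r
      rw [extend_clm_apply]
      congr 1
      funext a
      exact (hrun.2 (out a)).symm

/-! ### Costs -/

theorem time_seqs (l : List (Code L ι)) : (seqs l).time = (l.map time).sum := by
  induction l with
  | nil => rfl
  | cons c l ih => simpa [seqs, time] using ih

theorem space_seqs_le {l : List (Code L ι)} {B : ℕ} (h : ∀ c ∈ l, c.space ≤ B) :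
    (seqs l).space ≤ B := by
  induction l with
  | nil => exact Nat.zero_le _
  | cons c l ih =>
    exact max_le (h c (by simp)) (ih fun c hc => h c (by simp [hc]))

/-- An operation of cost `w` turns into two partial derivatives of cost at most `ρ w` each, itself,
and three unit operations, which are paid for by `1 ≤ w`. -/
theorem jvp_time_le (c : Code L ι) : c.jvp.time ≤ (2 * ρ + 4) * c.time := by
  induction c with
  | skip => simp [jvp, time]
  | op o dst a b =>
    have h1 := L.cost_d1 o
    have h2 := L.cost_d2 o
    have h3 := L.one_le_cost o
    simp only [jvp, seqs, List.foldr, time, L.cost_mul, L.cost_add]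
    nlinarith
  | seq c₁ c₂ ih₁ ih₂ =>
    simp only [jvp, time]
    linarith
  | call inp body out args dst ih =>
    simp only [jvp, time, Fintype.card_sum]
    nlinarith

/-- A frame of `m` registers becomes one of `2 m + 2`. With the cell of the call this is `2 m + 3`,
at most three times `m + 1`. -/
theorem jvp_space_le (c : Code L ι) : c.jvp.space ≤ 3 * c.space := by
  induction c with
  | skip => simp [jvp, space]
  | op o dst a b => simp [jvp, seqs, space]
  | seq c₁ c₂ ih₁ ih₂ =>
    simp only [jvp, space]
    omega
  | call inp body out args dst ih =>
    simp only [jvp, space, Fintype.card_sum, Fintype.card_fin]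
    omega

end Code

/-! ### Cost and correctness of differentiated procedures -/

namespace Proc

variable {ρ : ℕ} {L : ElemLib ρ} {α β : Type}

theorem jvp_time_le [Fintype α] [Fintype β] (P : Proc L α β) :
    P.jvp.time ≤ (2 * ρ + 4) * P.time := by
  have h := Code.jvp_time_le P.body
  simp only [Proc.time, Proc.jvp, Fintype.card_sum]
  nlinarith

theorem jvp_space_le (P : Proc L α β) : P.jvp.space ≤ 3 * P.space := by
  have h := Code.jvp_space_le P.body
  have hc : @Fintype.card P.jvp.Frame P.jvp.fintypeFrame = 2 * Fintype.card P.Frame + 2 := by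
    have : @Fintype.card P.jvp.Frame P.jvp.fintypeFrame = Fintype.card (Code.Dual P.Frame) := rfl
    rw [this]; simp; ring
  unfold Proc.space
  rw [hc]
  have : P.jvp.body.space = P.body.jvp.space := rfl
  omega

theorem call_time [Fintype α] [Fintype β] {ι : Type} (P : Proc L α β) (args : α → ι)
    (dst : β ↪ ι) : (P.call args dst).time = P.time := rfl

/-- This is `Code.jvp_spec` with the input vector itself as the parameter: the initial frame depends
linearly on it. Differentiability of `F` is a conclusion, drawn from safety of the program at every
input. -/
theorem Computes.jvp [Fintype α] [Fintype β] {P : Proc L α β} {F : (α → ℝ) → β → ℝ}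
    (h : P.Computes F) :
    Differentiable ℝ F ∧ P.jvp.Computes fun z =>
      Sum.elim (F (z ∘ Sum.inl)) (fderiv ℝ F (z ∘ Sum.inl) (z ∘ Sum.inr)) := by
  have key : ∀ x : α → ℝ, ∃ D : β → (α → ℝ) →L[ℝ] ℝ, HasFDerivAt F (ContinuousLinearMap.pi D) x ∧
      ∀ (v : α → ℝ) (τ : Code.Dual P.Frame → ℝ), Code.Carries τ (Function.extend P.inp x 0)
        (Function.extend P.inp v 0) → P.body.jvp.Safe τ ∧
          P.body.jvp.run τ ∘ Code.dualMap P.out = Sum.elim (F x) fun b => D b v := by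
    intro x
    obtain ⟨D, hD, H⟩ := Code.jvp_spec P.body (fun x : α → ℝ => Function.extend P.inp x 0)
      (Function.extend P.inp (fun a => ContinuousLinearMap.proj a) 0) x
      (Code.hasFDerivAt_extend P.inp (fun a => hasFDerivAt_apply a x)
        fun r => hasFDerivAt_const 0 x) (h x).1
    refine ⟨D ∘ P.out, ?_, fun v τ hτ => ?_⟩
    · have hF : F = P.eval := funext fun x => (h x).2.symm
      rw [hF, hasFDerivAt_pi]
      exact fun b => hD (P.out b)
    · obtain ⟨h1, h2⟩ := H v τ (by
        convert hτ using 1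
        funext r
        rw [Code.extend_clm_apply]
        rfl)
      refine ⟨h1, funext fun b => ?_⟩
      rcases b with b | b
      · simpa [Code.dualMap, h2.1, Proc.eval] using congrFun (h x).2 b
      · simp [Code.dualMap, h2.2]
  constructor
  · intro x
    obtain ⟨D, hD, -⟩ := key x
    exact hD.differentiableAt
  · intro z
    obtain ⟨D, hD, H⟩ := key (z ∘ Sum.inl)
    obtain ⟨h1, h2⟩ := H (z ∘ Sum.inr) _ (Code.extend_dualEmb P.inp z)
    refine ⟨h1, ?_⟩
    simp only [hD.fderiv]
    exact h2

end Proc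

namespace Code

variable {ρ : ℕ} {L : ElemLib ρ} {ι : Type}

/-! ### Reasoning about runs -/

/-- From every state with `Pre` the code runs safely to a state with `Post`. -/
def Triple (Pre : (ι → ℝ) → Prop) (c : Code L ι) (Post : (ι → ℝ) → Prop) : Prop :=
  ∀ σ, Pre σ → c.Safe σ ∧ Post (c.run σ)

theorem Triple.seq {c₁ c₂ : Code L ι} {Pre Mid Post : (ι → ℝ) → Prop} (h₁ : Triple Pre c₁ Mid)
    (h₂ : Triple Mid c₂ Post) : Triple Pre (c₁.seq c₂) Post := fun σ hσ =>
  ⟨⟨(h₁ σ hσ).1, (h₂ _ (h₁ σ hσ).2).1⟩, (h₂ _ (h₁ σ hσ).2).2⟩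

theorem Triple.nil {Pre : (ι → ℝ) → Prop} : Triple Pre (seqs ([] : List (Code L ι))) Pre :=
  fun _ hσ => ⟨trivial, hσ⟩

theorem Triple.cons {c : Code L ι} {l : List (Code L ι)} {Pre Mid Post : (ι → ℝ) → Prop}
    (h₁ : Triple Pre c Mid) (h₂ : Triple Mid (seqs l) Post) : Triple Pre (seqs (c :: l)) Post :=
  Triple.seq h₁ h₂

/-- A loop invariant that may depend on the iterations that are done. -/
theorem Triple.seqs_map {α : Type} {l : List α} {f : α → Code L ι} (Inv : List α → (ι → ℝ) → Prop)
    (h : ∀ pre a suf, pre ++ a :: suf = l → Triple (Inv pre) (f a) (Inv (pre ++ [a]))) :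
    Triple (Inv []) (seqs (l.map f)) (Inv l) := by
  suffices H : ∀ suf pre, pre ++ suf = l → Triple (Inv pre) (seqs (suf.map f)) (Inv l) from
    H l [] rfl
  intro suf
  induction suf with
  | nil =>
    rintro pre rfl
    rw [List.append_nil]
    exact Triple.nil
  | cons a suf ih =>
    intro pre hp
    exact Triple.cons (h pre a suf hp) (ih (pre ++ [a]) (by simpa using hp))

theorem run_op_self {o : L.Op} {dst a b : ι} {σ : ι → ℝ} :
    (op o dst a b).run σ dst = L.val o (σ a, σ b) := by
  simp [run]

theorem run_op_of_ne {o : L.Op} {dst a b r : ι} {σ : ι → ℝ} (h : r ≠ dst) :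
    (op o dst a b).run σ r = σ r := by
  simp [run, h]

/-- Applying an operation entry by entry. -/
theorem seqs_op_spec {n : ℕ} {o : L.Op} (ho : L.dom o = Set.univ) {dst p q : Fin n → ι}
    (hdst : Function.Injective dst) (hp : ∀ a a', dst a' = p a → a' = a)
    (hq : ∀ a a', dst a' = q a → a' = a) (σ : ι → ℝ) :
    (seqs ((List.finRange n).map fun a => op o (dst a) (p a) (q a))).Safe σ ∧
    (∀ a, (seqs ((List.finRange n).map fun a => op o (dst a) (p a) (q a))).run σ (dst a) =
      L.val o (σ (p a), σ (q a))) ∧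
    ∀ r, (∀ a, r ≠ dst a) →
      (seqs ((List.finRange n).map fun a => op o (dst a) (p a) (q a))).run σ r = σ r := by
  have key := Triple.seqs_map (l := List.finRange n)
    (f := fun a => op o (dst a) (p a) (q a))
    (fun pre τ => (∀ a ∈ pre, τ (dst a) = L.val o (σ (p a), σ (q a))) ∧
      ∀ r, (∀ a ∈ pre, r ≠ dst a) → τ r = σ r) (by
    rintro pre a suf hl τ ⟨h1, h2⟩
    have hnd : (pre ++ a :: suf).Nodup := hl ▸ List.nodup_finRange n
    have ha : a ∉ pre := fun h => (List.nodup_append.1 hnd).2.2 a h a (by simp) rfl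
    refine ⟨by simp [Safe, ho], ?_, ?_⟩
    · intro a' ha'
      by_cases h : a' = a
      · subst h
        rw [run_op_self, h2, h2]
        · exact fun a'' h'' e => ha (hq a' a'' e.symm ▸ h'')
        · exact fun a'' h'' e => ha (hp a' a'' e.symm ▸ h'')
      · rw [run_op_of_ne (hdst.ne h)]
        exact h1 a' (by simpa [h] using ha')
    · intro r hr
      rw [run_op_of_ne (hr a (by simp))]
      exact h2 r fun a' ha' => hr a' (by simp [ha']))
  obtain ⟨h1, h2, h3⟩ := key σ ⟨by simp, fun _ _ => rfl⟩
  exact ⟨h1, fun a => h2 a (List.mem_finRange a), fun r hr => h3 r fun a _ => hr a⟩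

/-- Adding up terms in the register `g` with the help of the register `t`. -/
theorem seqs_accumulate {α : Type} {l : List α} {f : α → Code L ι} {g t : ι} {w : α → ℝ}
    {σ : ι → ℝ}
    (h : ∀ a ∈ l, ∀ τ : ι → ℝ, (∀ r, r ≠ g → r ≠ t → τ r = σ r) →
      (f a).Safe τ ∧ (f a).run τ g = τ g + w a ∧ ∀ r, r ≠ g → r ≠ t → (f a).run τ r = τ r)
    {τ : ι → ℝ} (hτ : ∀ r, r ≠ g → r ≠ t → τ r = σ r) :
    (seqs (l.map f)).Safe τ ∧ (seqs (l.map f)).run τ g = τ g + (l.map w).sum ∧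
      ∀ r, r ≠ g → r ≠ t → (seqs (l.map f)).run τ r = τ r := by
  have key := Triple.seqs_map (l := l) (f := f)
    (fun pre τ' => τ' g = τ g + (pre.map w).sum ∧ ∀ r, r ≠ g → r ≠ t → τ' r = τ r) (by
    rintro pre a suf hl τ' ⟨h1, h2⟩
    obtain ⟨k1, k2, k3⟩ := h a (by simp [← hl]) τ' fun r hg ht => (h2 r hg ht).trans (hτ r hg ht)
    refine ⟨k1, ?_, fun r hg ht => (k3 r hg ht).trans (h2 r hg ht)⟩
    rw [k2, h1]
    simp [add_assoc])
  exact key τ ⟨by simp, fun _ _ _ => rfl⟩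

end Code

namespace Proc

variable {ρ : ℕ} {L : ElemLib ρ} {α β ι : Type} [Fintype α] [Fintype β]

theorem Computes.call_spec {P : Proc L α β} {F : (α → ℝ) → β → ℝ} (h : P.Computes F)
    (args : α → ι) (dst : β ↪ ι) (σ : ι → ℝ) :
    (P.call args dst).Safe σ ∧
    (∀ a, (P.call args dst).run σ (dst a) = F (σ ∘ args) a) ∧
    ∀ r, (∀ a, r ≠ dst a) → (P.call args dst).run σ r = σ r := by
  refine ⟨(h (σ ∘ args)).1, fun a => ?_, fun r hr => ?_⟩
  · simp only [Proc.call, Code.run, dst.injective.extend_apply]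
    exact congrFun (h (σ ∘ args)).2 a
  · simp only [Proc.call, Code.run]
    exact Function.extend_apply' _ _ _ fun ⟨a, ha⟩ => hr a ha.symm

end Proc

/-! ### Register bookkeeping and the update of one row -/

namespace GradAlgo

open Code

variable {ρ : ℕ} {L : ElemLib ρ} {N : ℕ} {P : MultilevelProblem N} {b : ℕ}
  {i : Fin (N + 1)} (A : GradAlgo L P b i)

theorem mem_lowerLevels (j : {j : Fin (N + 1) // i < j}) : j ∈ lowerLevels i := by
  simp [lowerLevels]

theorem pairwise_lowerLevels (i : Fin (N + 1)) : (lowerLevels i).Pairwise (· < ·) := by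
  refine List.Pairwise.filterMap _ ?_ (List.pairwise_lt_finRange _)
  intro a a' h c hc c' hc'
  simp only [Option.dite_none_right_eq_some, Option.some.injEq] at hc hc'
  obtain ⟨_, rfl⟩ := hc
  obtain ⟨_, rfl⟩ := hc'
  exact h

@[simp] theorem vec_inj {d : Fin (N + 1) → ℕ} {s s' : Slot b} {v v' : Coord d} :
    (Reg.vec s v : Reg d b i) = Reg.vec s' v' ↔ s = s' ∧ v = v' := by
  simp [Reg.vec]

@[simp] theorem zero_ne_vec {d : Fin (N + 1) → ℕ} {s : Slot b} {v : Coord d} :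
    (Reg.zero : Reg d b i) ≠ Reg.vec s v := by
  simp [Reg.vec, Reg.zero]

@[simp] theorem one_ne_vec {d : Fin (N + 1) → ℕ} {s : Slot b} {v : Coord d} :
    (Reg.one : Reg d b i) ≠ Reg.vec s v := by
  simp [Reg.vec, Reg.one]

@[simp] theorem g_ne_vec {d : Fin (N + 1) → ℕ} {s : Slot b} {v : Coord d} {k : Fin (d i)} :
    (Reg.g k : Reg d b i) ≠ Reg.vec s v := by
  simp [Reg.vec, Reg.g]

@[simp] theorem row_ne [NeZero b] {m : ℕ} (k : Fin m) : (row k : Slot b) ≠ Slot.x ∧ (row k : Slot b) ≠ Slot.y ∧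
    (row k : Slot b) ≠ Slot.w ∧ (row k : Slot b) ≠ Slot.bbar ∧ (row k : Slot b) ≠ Slot.grad := by
  simp [row]

/-- The pass number is the quotient `k / b` and the slot is the remainder `k % b`; together they
determine `k`. So rows of one pass never share a slot. -/
theorem row_inj [NeZero b] {m p : ℕ} {k k' : Fin m} (hk : k ∈ rows b p) (hk' : k' ∈ rows b p)
    (h : (row k : Slot b) = row k') : k = k' := by
  have h1 : k.val / b = p := by simpa [rows] using hk
  have h2 : k'.val / b = p := by simpa [rows] using hk'
  have h3 : k.val % b = k'.val % b := by
    simpa [row, Fin.ofNat, Fin.ext_iff] using h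
  apply Fin.ext
  rw [← Nat.div_add_mod k.val b, ← Nat.div_add_mod k'.val b, h1, h2, h3]

/-- The registers that the iterations of level `j` may change. -/
def blockRegs (b : ℕ) (i j : Fin (N + 1)) : Set (Reg P.d b i) :=
  {r | ∃ (s : Slot b) (a : Fin (P.d j)), s ≠ Slot.grad ∧ r = Reg.vec s ⟨j, a⟩}

/-- The auxiliary registers for the update of a row. -/
def scratch (b : ℕ) (i j : Fin (N + 1)) : Set (Reg P.d b i) :=
  {r | ∃ (s : Slot b) (a : Fin (P.d j)), (s = Slot.y ∨ s = Slot.w ∨ s = Slot.bbar) ∧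
    r = Reg.vec s ⟨j, a⟩}

theorem product_spec {j : {j : Fin (N + 1) // i < j}} {t : ℕ}
    {F : (CoordLE P.d j.1 → ℝ) → Fin (P.d j.1) → ℝ} (hF : (A.phi j t).Computes F)
    (dir : Coord P.d → Reg P.d b i) (s : Slot b) (hs : s ≠ Slot.y) (σ : Reg P.d b i → ℝ) :
    (A.product j t dir s hs).Safe σ ∧
    (∀ a, (A.product j t dir s hs).run σ (Reg.vec s ⟨j.1, a⟩) =
      fderiv ℝ F (fun v => σ (Reg.vec Slot.x v.1)) (fun v => σ (dir v.1)) a) ∧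
    ∀ r, (∀ a, r ≠ Reg.vec s ⟨j.1, a⟩ ∧ r ≠ Reg.vec Slot.y ⟨j.1, a⟩) →
      (A.product j t dir s hs).run σ r = σ r := by
  obtain ⟨h1, h2, h3⟩ := hF.jvp.2.call_spec
    (Sum.elim (fun v => Reg.vec Slot.x v.1) (fun v => dir v.1)) (Reg.blocks s hs j.1) σ
  refine ⟨h1, fun a => ?_, fun r hr => h3 r ?_⟩
  · exact h2 (Sum.inr a)
  · rintro (a | a)
    · exact (hr a).2
    · exact (hr a).1

/-- Here `u` is the whole tangent of the trajectory for row `k`: a unit vector on the levels up to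
`i`, the stored rows on the levels from there to `j`. The separate products with `B_j`, `C_{jl}` and
`A_j` add up to one Jacobian-vector product with `u`, by linearity. -/
theorem updateRow_spec [NeZero b] {j : {j : Fin (N + 1) // i < j}} {t : ℕ}
    {F : (CoordLE P.d j.1 → ℝ) → Fin (P.d j.1) → ℝ} (hF : (A.phi j t).Computes F)
    (k : Fin (P.d i)) {σ : Reg P.d b i → ℝ} (hzero : σ Reg.zero = 0) (hone : σ Reg.one = 1)
    {u : Coord P.d → ℝ} (hu : u ⟨i, k⟩ = 1)
    (hu' : ∀ v, v.1 ≤ i → v ≠ ⟨i, k⟩ → u v = 0)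
    (hz : ∀ v : Coord P.d, i < v.1 → v.1 ≤ j → σ (Reg.vec (row k) v) = u v) :
    (A.updateRow j t k).Safe σ ∧
    (∀ a, (A.updateRow j t k).run σ (Reg.vec (row k) ⟨j.1, a⟩) =
      fderiv ℝ F (fun v => σ (Reg.vec Slot.x v.1)) (fun v => u v.1) a) ∧
    ∀ r ∉ scratch b i j.1, (∀ a, r ≠ Reg.vec (row k) ⟨j.1, a⟩) →
      (A.updateRow j t k).run σ r = σ r := by
  classical
  set D := fderiv ℝ F (fun v => σ (Reg.vec Slot.x v.1)) with hD
  set l := (lowerLevels i).filter fun l => l < j with hl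
  have hlmem : ∀ m : {j : Fin (N + 1) // i < j}, m ∈ l ↔ m < j := by
    intro m
    simp [hl, mem_lowerLevels]
  have hlnd : l.Nodup := (pairwise_lowerLevels i).nodup.filter _
  -- the direction that is composed of the rows of the levels in `S`
  let dirOn (S : List {j : Fin (N + 1) // i < j}) (v : CoordLE P.d j.1) : ℝ :=
    if v.1 = ⟨i, k⟩ then 1 else if v.1.1 ∈ S.map Subtype.val then u v.1 else 0
  -- Everything before the final addition writes to scratch registers only, so every product is
  -- taken at the same point and with the old rows.
  let Off (τ : Reg P.d b i → ℝ) : Prop := ∀ r ∉ scratch b i j.1, τ r = σ r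
  let rowVec (m : Fin (N + 1)) (v : CoordLE P.d j.1) : ℝ := if v.1.1 = m then u v.1 else 0
  have hx : ∀ τ, Off τ → (fun v : CoordLE P.d j.1 => τ (Reg.vec Slot.x v.1)) =
      fun v => σ (Reg.vec Slot.x v.1) := fun τ hτ => funext fun v => hτ _ (by simp [scratch])
  have hrow : ∀ τ, Off τ → ∀ m : {j : Fin (N + 1) // i < j}, m ≤ j →
      (fun v : CoordLE P.d j.1 => τ (rowDir k m.1 v.1)) = rowVec m.1 := by
    intro τ hτ m hm
    funext v
    simp only [rowDir, rowVec]
    split_ifs with h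
    · rw [hτ _ (by simp [scratch])]
      exact hz _ (h ▸ m.2) (h ▸ hm)
    · rw [hτ _ (by simp [scratch]), hzero]
  have hrowprod : ∀ m : {j : Fin (N + 1) // i < j}, m ≤ j → ∀ τ, Off τ →
      (A.product j t (rowDir k m.1) Slot.w (by simp)).Safe τ ∧
      (∀ a, (A.product j t (rowDir k m.1) Slot.w (by simp)).run τ (Reg.vec Slot.w ⟨j.1, a⟩) =
        D (rowVec m.1) a) ∧
      (∀ a, (A.product j t (rowDir k m.1) Slot.w (by simp)).run τ (Reg.vec Slot.bbar ⟨j.1, a⟩) =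
        τ (Reg.vec Slot.bbar ⟨j.1, a⟩)) ∧
      Off ((A.product j t (rowDir k m.1) Slot.w (by simp)).run τ) := by
    intro m hm τ hτ
    obtain ⟨h1, h2, h3⟩ := A.product_spec hF (rowDir k m.1) Slot.w (by simp) τ
    refine ⟨h1, fun a => ?_, fun a => h3 _ (by simp), fun r hr => ?_⟩
    · rw [h2, hx τ hτ, hrow τ hτ m hm]
    · rw [h3, hτ r hr]
      exact fun a => ⟨fun h => hr ⟨_, a, by simp, h⟩, fun h => hr ⟨_, a, by simp, h⟩⟩
  have T1 : Triple (fun τ => τ = σ) (A.product j t (unitDir k) Slot.bbar (by simp))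
      (fun τ => (∀ a, τ (Reg.vec Slot.bbar ⟨j.1, a⟩) = D (dirOn []) a) ∧ Off τ) := by
    rintro τ rfl
    obtain ⟨h1, h2, h3⟩ := A.product_spec hF (unitDir k) Slot.bbar (by simp) τ
    refine ⟨h1, fun a => ?_, fun r hr => ?_⟩
    · have e : (fun v : CoordLE P.d j.1 => τ (unitDir k v.1)) = dirOn [] := by
        funext v
        by_cases h : v.1 = ⟨i, k⟩
        · simp [unitDir, dirOn, h, hone]
        · simp [unitDir, dirOn, h, hzero]
      rw [h2, e]
    · rw [h3]
      exact fun a => ⟨fun h => hr ⟨_, a, by simp, h⟩, fun h => hr ⟨_, a, by simp, h⟩⟩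
  have T2 := Triple.seqs_map (l := l) (f := fun m =>
      Code.seq (A.product j t (rowDir k m.1) Slot.w (by simp))
        (seqs ((List.finRange (P.d j.1)).map fun a =>
          op L.add (Reg.vec Slot.bbar ⟨j.1, a⟩) (Reg.vec Slot.bbar ⟨j.1, a⟩)
            (Reg.vec Slot.w ⟨j.1, a⟩))))
    (fun pre τ => (∀ a, τ (Reg.vec Slot.bbar ⟨j.1, a⟩) = D (dirOn pre) a) ∧ Off τ) (by
    rintro pre m suf hpre τ ⟨hτ1, hτ2⟩
    have hm : m < j := (hlmem m).1 (by simp [← hpre])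
    have hmpre : m ∉ pre := fun h =>
      (List.nodup_append.1 (hpre ▸ hlnd : (pre ++ m :: suf).Nodup)).2.2 m h m (by simp) rfl
    obtain ⟨h1, h2, h3, h4⟩ := hrowprod m hm.le τ hτ2
    obtain ⟨k1, k2, k3⟩ := seqs_op_spec (L := L) L.dom_add
      (dst := fun a => Reg.vec (i := i) (b := b) Slot.bbar (⟨j.1, a⟩ : Coord P.d))
      (p := fun a => Reg.vec Slot.bbar ⟨j.1, a⟩) (q := fun a => Reg.vec Slot.w ⟨j.1, a⟩)
      (fun a a' h => by simpa using h) (fun a a' h => by simpa using h)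
      (fun a a' h => by simp at h)
      ((A.product j t (rowDir k m.1) Slot.w (by simp)).run τ)
    refine ⟨⟨h1, k1⟩, fun a => ?_, fun r hr => ?_⟩
    · have e : dirOn (pre ++ [m]) = dirOn pre + rowVec m.1 := by
        funext v
        have hmi := m.2
        simp only [dirOn, rowVec, List.map_append, List.map_cons, List.map_nil, List.mem_append,
          List.mem_singleton, Pi.add_apply]
        by_cases hv : v.1 = ⟨i, k⟩
        · have : v.1.1 ≠ m.1 := by rw [hv]; exact hmi.ne
          rw [if_pos hv, if_pos hv, if_neg this, add_zero]
        · by_cases hvm : v.1.1 = m.1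
          · have hn : v.1.1 ∉ pre.map Subtype.val := by
              rw [hvm]
              intro h
              obtain ⟨m', hm', e⟩ := List.mem_map.1 h
              exact hmpre (Subtype.ext e ▸ hm')
            rw [if_neg hv, if_pos (Or.inr hvm), if_neg hv, if_neg hn, if_pos hvm, zero_add]
          · simp only [hv, hvm, or_false, if_false, add_zero]
      refine (k2 a).trans ?_
      rw [L.val_add, h2, h3, hτ1, e, map_add]
      rfl
    · refine (k3 r fun a h => hr ⟨_, a, by simp, h⟩).trans (h4 r hr))
  have T3 : Triple (fun τ => (∀ a, τ (Reg.vec Slot.bbar ⟨j.1, a⟩) = D (dirOn l) a) ∧ Off τ)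
      (A.product j t (rowDir k j.1) Slot.w (by simp))
      (fun τ => (∀ a, τ (Reg.vec Slot.bbar ⟨j.1, a⟩) = D (dirOn l) a) ∧
        (∀ a, τ (Reg.vec Slot.w ⟨j.1, a⟩) = D (rowVec j.1) a) ∧ Off τ) := by
    rintro τ ⟨hτ1, hτ2⟩
    obtain ⟨h1, h2, h3, h4⟩ := hrowprod j le_rfl τ hτ2
    exact ⟨h1, fun a => (h3 a).trans (hτ1 a), h2, h4⟩
  have T4 : Triple (fun τ => (∀ a, τ (Reg.vec Slot.bbar ⟨j.1, a⟩) = D (dirOn l) a) ∧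
        (∀ a, τ (Reg.vec Slot.w ⟨j.1, a⟩) = D (rowVec j.1) a) ∧ Off τ)
      (seqs ((List.finRange (P.d j.1)).map fun a =>
        op L.add (Reg.vec (row k) ⟨j.1, a⟩) (Reg.vec Slot.w ⟨j.1, a⟩)
          (Reg.vec Slot.bbar ⟨j.1, a⟩)))
      (fun τ => (∀ a, τ (Reg.vec (row k) ⟨j.1, a⟩) = D (fun v => u v.1) a) ∧
        ∀ r ∉ scratch b i j.1, (∀ a, r ≠ Reg.vec (row k) ⟨j.1, a⟩) → τ r = σ r) := by
    rintro τ ⟨hτ1, hτ2, hτ3⟩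
    obtain ⟨k1, k2, k3⟩ := seqs_op_spec (L := L) L.dom_add
      (dst := fun a => Reg.vec (i := i) (b := b) (row k) (⟨j.1, a⟩ : Coord P.d))
      (p := fun a => Reg.vec Slot.w ⟨j.1, a⟩) (q := fun a => Reg.vec Slot.bbar ⟨j.1, a⟩)
      (fun a a' h => by simpa using h) (fun a a' h => by simp at h)
      (fun a a' h => by simp at h) τ
    refine ⟨k1, fun a => ?_, fun r hr hr' => (k3 r hr').trans (hτ3 r hr)⟩
    -- By level of the coordinate: up to `i` only the unit coordinate is nonzero, level `j` is
    -- `rowVec j.1`, and each level strictly between belongs to `l`.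
    have e : (fun v : CoordLE P.d j.1 => u v.1) = rowVec j.1 + dirOn l := by
      funext v
      have hji := j.2
      by_cases hv : v.1 = ⟨i, k⟩
      · have : i ≠ j.1 := hji.ne
        simp [dirOn, rowVec, hv, this, hu]
      · rcases le_or_gt v.1.1 i with h | h
        · have h' : v.1.1 ≠ j.1 := (h.trans_lt hji).ne
          simp [dirOn, rowVec, hv, hu' _ h hv, h.not_gt, h']
        · by_cases h' : v.1.1 = j.1
          · have : ∀ hh, (⟨v.1.1, hh⟩ : {j : Fin (N + 1) // i < j}) ∉ l := by
              intro hh hm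
              exact ((hlmem _).1 hm).ne (Subtype.ext h')
            have hjl : j ∉ l := fun hm => ((hlmem _).1 hm).ne rfl
            simp [dirOn, rowVec, hv, h', hjl]
          · have : (⟨v.1.1, h⟩ : {j : Fin (N + 1) // i < j}) ∈ l :=
              (hlmem _).2 (lt_of_le_of_ne v.2 fun e => h' (congrArg Subtype.val e))
            simp [dirOn, rowVec, hv, h', this, h]
    refine (k2 a).trans ?_
    rw [L.val_add, hτ1, hτ2, e, map_add]
    rfl
  exact (T1.cons (T2.cons (T3.cons (T4.cons Triple.nil)))) σ rfl

end GradAlgo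

/-! ### Differentiation of a block replacement -/

namespace MultilevelProblem

variable {N : ℕ} (P : MultilevelProblem N)

theorem setBlock_self (x : Coord P.d → ℝ) (j : Fin (N + 1)) (y : Fin (P.d j) → ℝ)
    (a : Fin (P.d j)) : P.setBlock x j y ⟨j, a⟩ = y a :=
  sigma_mk_injective.extend_apply _ _ _

theorem setBlock_of_ne (x : Coord P.d → ℝ) {j : Fin (N + 1)} (y : Fin (P.d j) → ℝ)
    {v : Coord P.d} (h : v.1 ≠ j) : P.setBlock x j y v = x v :=
  Function.extend_apply' _ _ _ fun ⟨_, ha⟩ => h (ha ▸ rfl)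

/-- Replacing a block of the variables by a differentiable function of them. -/
theorem hasFDerivAt_setBlock {E : Type} [NormedAddCommGroup E] [NormedSpace ℝ E]
    {X : E → Coord P.d → ℝ} {X' : E →L[ℝ] Coord P.d → ℝ} {x₀ : E} (hX : HasFDerivAt X X' x₀)
    {j : Fin (N + 1)} {Y : E → Fin (P.d j) → ℝ} {Y' : E →L[ℝ] Fin (P.d j) → ℝ}
    (hY : HasFDerivAt Y Y' x₀) :
    ∃ Z' : E →L[ℝ] Coord P.d → ℝ, HasFDerivAt (fun x => P.setBlock (X x) j (Y x)) Z' x₀ ∧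
      ∀ e, Z' e = P.setBlock (X' e) j (Y' e) := by
  have hX' := hasFDerivAt_pi'.1 hX
  have hY' := hasFDerivAt_pi'.1 hY
  let e : Fin (P.d j) ↪ Coord P.d := Function.Embedding.sigmaMk (β := fun j => Fin (P.d j)) j
  refine ⟨ContinuousLinearMap.pi (Function.extend e
    (fun a => (ContinuousLinearMap.proj a).comp Y') fun v => (ContinuousLinearMap.proj v).comp X'),
    hasFDerivAt_pi.2 (Code.hasFDerivAt_extend e hY' hX'), fun w => funext fun v => ?_⟩
  exact Code.extend_clm_apply e _ _ w v

end MultilevelProblem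

/-! ### Effect of the initialisation and of one iteration -/

namespace GradAlgo

open Code

variable {ρ : ℕ} {L : ElemLib ρ} {N : ℕ} {P : MultilevelProblem N} {b : ℕ}
  {i : Fin (N + 1)} (A : GradAlgo L P b i)

theorem zero_not_mem_blockRegs {j : Fin (N + 1)} : (Reg.zero : Reg P.d b i) ∉ blockRegs b i j := by
  simp [blockRegs]

theorem one_not_mem_blockRegs {j : Fin (N + 1)} : (Reg.one : Reg P.d b i) ∉ blockRegs b i j := by
  simp [blockRegs]

theorem vec_not_mem_blockRegs {j : Fin (N + 1)} {s : Slot b} {v : Coord P.d} (h : v.1 ≠ j) :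
    (Reg.vec s v : Reg P.d b i) ∉ blockRegs b i j := by
  rintro ⟨s', a, -, h'⟩
  exact h ((vec_inj.1 h').2 ▸ rfl)

theorem scratch_subset {j : Fin (N + 1)} : scratch (P := P) b i j ⊆ blockRegs b i j := by
  rintro r ⟨s, a, h, rfl⟩
  exact ⟨s, a, by rcases h with rfl | rfl | rfl <;> simp, rfl⟩

variable [NeZero b]

theorem init_spec (p : ℕ) (j : {j : Fin (N + 1) // i < j}) (σ : Reg P.d b i → ℝ) :
    (init (L := L) p j).Safe σ ∧
    (∀ a, (init (L := L) p j).run σ (Reg.vec Slot.x ⟨j.1, a⟩) = P.x0 ⟨j.1, a⟩) ∧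
    (∀ k ∈ rows b p, ∀ a, (init (L := L) p j).run σ (Reg.vec (row (k : Fin (P.d i))) ⟨j.1, a⟩) = 0) ∧
    ∀ r ∉ blockRegs b i j.1, (init (L := L) p j).run σ r = σ r := by
  have hin : ∀ (a : Fin (P.d j.1)) (τ : Reg P.d b i → ℝ),
      let c := seqs ((rows b p).map fun k : Fin (P.d i) =>
        op (L.const 0) (Reg.vec (row k) ⟨j.1, a⟩ : Reg P.d b i) Reg.zero Reg.zero)
      c.Safe τ ∧ (∀ k ∈ rows b p, c.run τ (Reg.vec (row (k : Fin (P.d i))) ⟨j.1, a⟩) = 0) ∧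
        ∀ r, (∀ k : Fin (P.d i), r ≠ Reg.vec (row k) ⟨j.1, a⟩) → c.run τ r = τ r := by
    intro a τ
    refine Triple.seqs_map (l := rows b p) (f := fun k : Fin (P.d i) =>
        op (L.const 0) (Reg.vec (row k) ⟨j.1, a⟩ : Reg P.d b i) Reg.zero Reg.zero)
      (fun pre τ' => (∀ k ∈ pre, τ' (Reg.vec (row k) ⟨j.1, a⟩) = 0) ∧
        ∀ r, (∀ k : Fin (P.d i), r ≠ Reg.vec (row k) ⟨j.1, a⟩) → τ' r = τ r) ?_ τ
        ⟨by simp, fun _ _ => rfl⟩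
    rintro pre k suf - τ' ⟨h1, h2⟩
    refine ⟨by simp [Safe, L.dom_const], fun k' hk' => ?_, fun r hr => ?_⟩
    -- Distinctness of the slots is not needed here, since writing zero twice is harmless.
    · by_cases h : (row k' : Slot b) = row k
      · rw [h, run_op_self, L.val_const]
      · rw [run_op_of_ne (by simp [h])]
        refine h1 k' ?_
        have : k' ≠ k := fun e => h (e ▸ rfl)
        simpa [this] using hk'
    · rw [run_op_of_ne (hr k)]
      exact h2 r hr
  have key := Triple.seqs_map (l := List.finRange (P.d j.1)) (f := fun a =>
      Code.seq (op (L.const (P.x0 ⟨j.1, a⟩)) (Reg.vec Slot.x ⟨j.1, a⟩) Reg.zero Reg.zero)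
      (seqs ((rows b p).map fun k : Fin (P.d i) =>
        op (L.const 0) (Reg.vec (row k) ⟨j.1, a⟩ : Reg P.d b i) Reg.zero Reg.zero)))
    (fun pre τ => (∀ a ∈ pre, τ (Reg.vec Slot.x ⟨j.1, a⟩) = P.x0 ⟨j.1, a⟩) ∧
      (∀ k ∈ rows b p, ∀ a ∈ pre, τ (Reg.vec (row (k : Fin (P.d i))) ⟨j.1, a⟩) = 0) ∧
      ∀ r ∉ blockRegs b i j.1, τ r = σ r) (by
    rintro pre a suf - τ ⟨h1, h2, h3⟩
    obtain ⟨k1, k2, k3⟩ := hin a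
      ((op (L.const (P.x0 ⟨j.1, a⟩)) (Reg.vec Slot.x ⟨j.1, a⟩) Reg.zero Reg.zero).run τ)
    refine ⟨⟨by simp [Safe, L.dom_const], k1⟩, fun a' ha' => ?_, fun k hk a' ha' => ?_,
      fun r hr => ?_⟩
    · refine (k3 _ fun k => by simp [(row_ne k).1.symm]).trans ?_
      by_cases h : a' = a
      · subst h
        rw [run_op_self, L.val_const]
      · rw [run_op_of_ne (by simpa using h)]
        exact h1 a' (by simpa [h] using ha')
    · by_cases h : a' = a
      · subst h
        exact k2 k hk
      · refine (k3 _ fun k' => by simp [h]).trans ?_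
        rw [run_op_of_ne (by simp)]
        exact h2 k hk a' (by simpa [h] using ha')
    · refine (k3 r fun k h => hr ⟨_, a, by simp, h⟩).trans ?_
      rw [run_op_of_ne fun h => hr ⟨_, a, by simp, h⟩]
      exact h3 r hr)
  obtain ⟨h1, h2, h3, h4⟩ := key σ ⟨by simp, by simp, fun _ _ => rfl⟩
  exact ⟨h1, fun a => h2 a (List.mem_finRange a), fun k hk a => h3 k hk a (List.mem_finRange a), h4⟩

/-- All rows are updated while block `j` of `x` still holds the previous iterate, so the new iterate
and its derivative refer to the same point. -/
theorem step_spec {p : ℕ} {j : {j : Fin (N + 1) // i < j}} {t : ℕ}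
    {F : (CoordLE P.d j.1 → ℝ) → Fin (P.d j.1) → ℝ} (hF : (A.phi j t).Computes F)
    {σ : Reg P.d b i → ℝ} (hzero : σ Reg.zero = 0) (hone : σ Reg.one = 1)
    {u : Fin (P.d i) → Coord P.d → ℝ} (hu : ∀ k, u k ⟨i, k⟩ = 1)
    (hu' : ∀ k v, v.1 ≤ i → v ≠ ⟨i, k⟩ → u k v = 0)
    (hz : ∀ k ∈ rows b p, ∀ v : Coord P.d, i < v.1 → v.1 ≤ j → σ (Reg.vec (row k) v) = u k v) :
    (A.step p j t).Safe σ ∧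
    (∀ a, (A.step p j t).run σ (Reg.vec Slot.x ⟨j.1, a⟩) =
      F (fun v => σ (Reg.vec Slot.x v.1)) a) ∧
    (∀ k ∈ rows b p, ∀ a, (A.step p j t).run σ (Reg.vec (row k) ⟨j.1, a⟩) =
      fderiv ℝ F (fun v => σ (Reg.vec Slot.x v.1)) (fun v => u k v.1) a) ∧
    ∀ r ∉ blockRegs b i j.1, (A.step p j t).run σ r = σ r := by
  have T1 := Triple.seqs_map (l := rows b p) (f := fun k => A.updateRow j t k)
    (fun pre τ => (∀ k ∈ pre, ∀ a, τ (Reg.vec (row k) ⟨j.1, a⟩) =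
      fderiv ℝ F (fun v => σ (Reg.vec Slot.x v.1)) (fun v => u k v.1) a) ∧
      ∀ r ∉ scratch b i j.1, (∀ k ∈ pre, ∀ a, r ≠ Reg.vec (row k) ⟨j.1, a⟩) → τ r = σ r) (by
    rintro pre k suf hl τ ⟨h1, h2⟩
    have hnd : (pre ++ k :: suf).Nodup := hl ▸ (List.nodup_finRange _).filter _
    have hk : k ∈ rows b p := by simp [← hl]
    -- The update of row `k` must not destroy the rows that are already finished.
    have hpre : ∀ k' ∈ pre, (row k' : Slot b) ≠ row k := fun k' hk' h => by
      have := row_inj (by simp [← hl, hk']) hk h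
      exact (List.nodup_append.1 hnd).2.2 k' hk' k (by simp) this
    have hx : (fun v : CoordLE P.d j.1 => τ (Reg.vec Slot.x v.1)) =
        fun v => σ (Reg.vec Slot.x v.1) :=
      funext fun v => h2 _ (by simp [scratch]) fun k' _ a => by simp [(row_ne k').1.symm]
    obtain ⟨k1, k2, k3⟩ := A.updateRow_spec hF k (σ := τ)
      ((h2 _ (by simp [scratch]) (by simp)).trans hzero)
      ((h2 _ (by simp [scratch]) (by simp)).trans hone) (hu k) (hu' k) (by
        intro v hv hv'
        rw [h2 _ (by simp [scratch]) fun k' hk' a => by simp [(hpre k' hk').symm]]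
        exact hz k hk v hv hv')
    refine ⟨k1, fun k' hk' a => ?_, fun r hr hr' => ?_⟩
    · by_cases h : k' = k
      · subst h
        rw [k2, hx]
      · have hk'' : k' ∈ pre := by simpa [h] using hk'
        rw [k3 _ (by simp [scratch]) fun a' => by simp [hpre k' hk'']]
        exact h1 k' hk'' a
    · rw [k3 r hr (hr' k (by simp))]
      exact h2 r hr fun k' hk' => hr' k' (by simp [hk']))
  have T2 : Triple (fun τ => (∀ k ∈ rows b p, ∀ a, τ (Reg.vec (row k) ⟨j.1, a⟩) =
      fderiv ℝ F (fun v => σ (Reg.vec Slot.x v.1)) (fun v => u k v.1) a) ∧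
      ∀ r ∉ scratch b i j.1, (∀ k ∈ rows b p, ∀ a, r ≠ Reg.vec (row (k : Fin (P.d i))) ⟨j.1, a⟩) →
        τ r = σ r)
      ((A.phi j t).call (fun v => Reg.vec Slot.x v.1) (Reg.block Slot.x j.1))
      (fun τ => (∀ a, τ (Reg.vec Slot.x ⟨j.1, a⟩) = F (fun v => σ (Reg.vec Slot.x v.1)) a) ∧
      (∀ k ∈ rows b p, ∀ a, τ (Reg.vec (row k) ⟨j.1, a⟩) =
        fderiv ℝ F (fun v => σ (Reg.vec Slot.x v.1)) (fun v => u k v.1) a) ∧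
      ∀ r ∉ blockRegs b i j.1, τ r = σ r) := by
    rintro τ ⟨h1, h2⟩
    obtain ⟨k1, k2, k3⟩ := hF.call_spec (fun v => Reg.vec Slot.x v.1) (Reg.block Slot.x j.1) τ
    have hx : (τ ∘ fun v : CoordLE P.d j.1 => Reg.vec Slot.x v.1) =
        fun v => σ (Reg.vec Slot.x v.1) :=
      funext fun v => h2 _ (by simp [scratch]) fun k' _ a => by simp [(row_ne k').1.symm]
    refine ⟨k1, fun a => (k2 a).trans (by rw [hx]), fun k hk a => ?_, fun r hr => ?_⟩
    · rw [k3 _ fun a h => (row_ne k).1 (vec_inj.1 h).1]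
      exact h1 k hk a
    · rw [k3 r fun a h => hr ⟨_, a, by simp, h⟩]
      exact h2 r (fun h => hr (scratch_subset h)) fun k _ a h => hr ⟨_, a, by simp, h⟩
  exact T1.seq T2 σ ⟨by simp, fun _ _ _ => rfl⟩

/-! ### The loops compute the derivatives of the iterates -/

/-- The direction of the `k`-th coordinate of the variable of level `i`. -/
noncomputable def basisVec (P : MultilevelProblem N) (i : Fin (N + 1)) (k : Fin (P.d i)) :
    CoordLE P.d i → ℝ :=
  Pi.single ⟨⟨i, k⟩, le_rfl⟩ 1

/-- `X` is a differentiable function of the variables of the levels up to `i` that gives the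
current values of all variables. -/
structure IsTrajectory (P : MultilevelProblem N) (i : Fin (N + 1))
    (X : (CoordLE P.d i → ℝ) → Coord P.d → ℝ) : Prop where
  differentiable : Differentiable ℝ X
  top : ∀ x v, (h : v.1 ≤ i) → X x v = x ⟨v, h⟩

/-- The state `σ` of the algorithm holds the values of `X` and the rows of its derivative for the levels
in `S`; the registers that belong to no level below `i` are as in `σ₀`. -/
structure Holds (p : ℕ) (x₀ : CoordLE P.d i → ℝ) (σ₀ : Reg P.d b i → ℝ) (S : Fin (N + 1) → Prop)
    (X : (CoordLE P.d i → ℝ) → Coord P.d → ℝ) (σ : Reg P.d b i → ℝ) : Prop where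
  val : ∀ v, i < v.1 → S v.1 → σ (Reg.vec Slot.x v) = X x₀ v
  tan : ∀ k ∈ rows b p, ∀ v : Coord P.d, i < v.1 → S v.1 →
    σ (Reg.vec (row k) v) = fderiv ℝ X x₀ (basisVec P i k) v
  frame : ∀ r, (∀ j, i < j → r ∉ blockRegs b i j) → σ r = σ₀ r

/-- On the levels up to `i` a trajectory is the identity. This makes the derivative in direction `k`
a unit vector there, as `updateRow_spec` requires. -/
theorem IsTrajectory.fderiv_top {X : (CoordLE P.d i → ℝ) → Coord P.d → ℝ}
    (hX : IsTrajectory P i X) (x₀ e : CoordLE P.d i → ℝ) {v : Coord P.d} (h : v.1 ≤ i) :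
    fderiv ℝ X x₀ e v = e ⟨v, h⟩ := by
  have h1 := hasFDerivAt_pi'.1 (hX.differentiable x₀).hasFDerivAt v
  have h2 : HasFDerivAt (fun x => X x v)
      (ContinuousLinearMap.proj (R := ℝ) (φ := fun _ : CoordLE P.d i => ℝ) ⟨v, h⟩) x₀ := by
    have : (fun x => X x v) = fun x => x ⟨v, h⟩ := funext fun x => hX.top x v h
    rw [this]
    exact hasFDerivAt_apply _ _
  exact congrArg (fun f => f e) (h1.unique h2)

theorem isTrajectory_extend :
    IsTrajectory P i (fun x => Function.extend Subtype.val x 0) where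
  differentiable := fun x => by
    let e : CoordLE P.d i ↪ Coord P.d := Function.Embedding.subtype _
    exact (hasFDerivAt_pi.2 (Code.hasFDerivAt_extend e (fun a => hasFDerivAt_apply a x)
      fun r => hasFDerivAt_const 0 x)).differentiableAt
  top := fun x v h => Subtype.val_injective.extend_apply x 0 ⟨v, h⟩

theorem IsTrajectory.setBlock {X : (CoordLE P.d i → ℝ) → Coord P.d → ℝ}
    (hX : IsTrajectory P i X) {j : Fin (N + 1)} (hj : i < j)
    {Y : (CoordLE P.d i → ℝ) → Fin (P.d j) → ℝ} (hY : Differentiable ℝ Y) :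
    IsTrajectory P i (fun x => P.setBlock (X x) j (Y x)) where
  differentiable := fun x => by
    obtain ⟨Z', hZ', -⟩ := P.hasFDerivAt_setBlock (hX.differentiable x).hasFDerivAt
      (hY x).hasFDerivAt
    exact hZ'.differentiableAt
  top := fun x v h => by
    rw [P.setBlock_of_ne _ _ (h.trans_lt hj).ne]
    exact hX.top x v h

theorem IsTrajectory.fderiv_setBlock {X : (CoordLE P.d i → ℝ) → Coord P.d → ℝ}
    (hX : IsTrajectory P i X) {j : Fin (N + 1)}
    {Y : (CoordLE P.d i → ℝ) → Fin (P.d j) → ℝ} (hY : Differentiable ℝ Y)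
    (x₀ e : CoordLE P.d i → ℝ) :
    fderiv ℝ (fun x => P.setBlock (X x) j (Y x)) x₀ e =
      P.setBlock (fderiv ℝ X x₀ e) j (fderiv ℝ Y x₀ e) := by
  obtain ⟨Z', hZ', h⟩ := P.hasFDerivAt_setBlock (hX.differentiable x₀).hasFDerivAt
    (hY x₀).hasFDerivAt
  rw [hZ'.fderiv, h]

/-- Restriction to the levels up to `j`. -/
noncomputable def restrict (P : MultilevelProblem N) (j : Fin (N + 1)) :
    (Coord P.d → ℝ) →L[ℝ] CoordLE P.d j → ℝ :=
  ContinuousLinearMap.pi fun v => ContinuousLinearMap.proj v.1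

/-- The initial point is constant, so its derivative is the zero block. Level `j` joins the set `S`
of valid levels only here; before that its registers may hold values left over from an earlier pass.
-/
theorem init_holds {p : ℕ} {x₀ : CoordLE P.d i → ℝ} {σ₀ : Reg P.d b i → ℝ}
    {S : Fin (N + 1) → Prop} {X : (CoordLE P.d i → ℝ) → Coord P.d → ℝ} (hX : IsTrajectory P i X)
    (j : {j : Fin (N + 1) // i < j}) :
    Triple (Holds p x₀ σ₀ S X) (init (L := L) p j) (Holds p x₀ σ₀ (fun m => S m ∨ m = j.1)
      fun x => P.setBlock (X x) j.1 fun a => P.x0 ⟨j.1, a⟩) := by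
  intro σ hσ
  obtain ⟨h1, h2, h3, h4⟩ := init_spec (L := L) p j σ
  refine ⟨h1, ⟨fun v hv hS => ?_, fun k hk v hv hS => ?_, fun r hr => ?_⟩⟩
  · by_cases h : v.1 = j.1
    · obtain ⟨m, a⟩ := v
      obtain rfl : m = j.1 := h
      rw [h2, P.setBlock_self]
    · rw [h4 _ (vec_not_mem_blockRegs h), P.setBlock_of_ne _ _ h]
      exact hσ.val v hv (hS.resolve_right h)
  · rw [hX.fderiv_setBlock (differentiable_const _)]
    by_cases h : v.1 = j.1
    · obtain ⟨m, a⟩ := v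
      obtain rfl : m = j.1 := h
      rw [h3 k hk, P.setBlock_self]
      simp
    · rw [h4 _ (vec_not_mem_blockRegs h), P.setBlock_of_ne _ _ h]
      exact hσ.tan k hk v hv (hS.resolve_right h)
  · rw [h4 r (hr j.1 j.2)]
    exact hσ.frame r hr

/-- This is the chain rule for `Φ_j^(t)` composed with the restriction of `X` to the levels up to
`j`, whose derivative in direction `k` is the vector `u` of `step_spec`. -/
theorem step_holds {p : ℕ} {x₀ : CoordLE P.d i → ℝ} {σ₀ : Reg P.d b i → ℝ}
    (hzero : σ₀ Reg.zero = 0) (hone : σ₀ Reg.one = 1)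
    (htop : ∀ v, (h : v.1 ≤ i) → σ₀ (Reg.vec Slot.x v) = x₀ ⟨v, h⟩)
    {S : Fin (N + 1) → Prop} {X : (CoordLE P.d i → ℝ) → Coord P.d → ℝ} (hX : IsTrajectory P i X)
    {j : {j : Fin (N + 1) // i < j}} (hS : ∀ m, i < m → m ≤ j.1 → S m) {t : ℕ}
    (hΦ : (A.phi j t).Computes (P.Φ j.1 t)) :
    Triple (Holds p x₀ σ₀ S X) (A.step p j t) (Holds p x₀ σ₀ S
      fun x => P.setBlock (X x) j.1 (P.Φ j.1 t fun v => X x v.1)) := by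
  intro σ hσ
  have hY : Differentiable ℝ fun x => P.Φ j.1 t (restrict P j.1 (X x)) :=
    hΦ.jvp.1.comp ((restrict P j.1).differentiable.comp hX.differentiable)
  have hval : ∀ v : Coord P.d, v.1 ≤ j.1 → σ (Reg.vec Slot.x v) = X x₀ v := by
    intro v hv
    rcases le_or_gt v.1 i with h | h
    · rw [hX.top x₀ v h, ← htop v h]
      exact hσ.frame _ fun m hm => vec_not_mem_blockRegs (h.trans_lt hm).ne
    · exact hσ.val v h (hS _ h hv)
  obtain ⟨h1, h2, h3, h4⟩ := A.step_spec hΦ (p := p) (σ := σ)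
    ((hσ.frame _ fun _ _ => zero_not_mem_blockRegs).trans hzero)
    ((hσ.frame _ fun _ _ => one_not_mem_blockRegs).trans hone)
    (u := fun k => fderiv ℝ X x₀ (basisVec P i k))
    (fun k => by rw [hX.fderiv_top _ _ le_rfl]; simp [basisVec])
    (fun k v hv hne => by
      rw [hX.fderiv_top _ _ hv, basisVec, Pi.single_eq_of_ne]
      exact fun h => hne (congrArg Subtype.val h))
    (fun k hk v hv hv' => hσ.tan k hk v hv (hS _ hv hv'))
  have hx : (fun v : CoordLE P.d j.1 => σ (Reg.vec Slot.x v.1)) = restrict P j.1 (X x₀) :=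
    funext fun v => hval v.1 v.2
  rw [hx] at h2 h3
  refine ⟨h1, ⟨fun v hv hSv => ?_, fun k hk v hv hSv => ?_, fun r hr => ?_⟩⟩
  · by_cases h : v.1 = j.1
    · obtain ⟨m, a⟩ := v
      obtain rfl : m = j.1 := h
      rw [h2, P.setBlock_self]
      rfl
    · rw [h4 _ (vec_not_mem_blockRegs h), P.setBlock_of_ne _ _ h]
      exact hσ.val v hv hSv
  · refine Eq.trans ?_ (congrFun (hX.fderiv_setBlock hY x₀ (basisVec P i k)) v).symm
    by_cases h : v.1 = j.1
    · obtain ⟨m, a⟩ := v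
      obtain rfl : m = j.1 := h
      rw [h3 k hk, P.setBlock_self]
      have hc : HasFDerivAt (fun x => P.Φ j.1 t (restrict P j.1 (X x)))
          ((fderiv ℝ (P.Φ j.1 t) (restrict P j.1 (X x₀))).comp
            ((restrict P j.1).comp (fderiv ℝ X x₀))) x₀ :=
        (hΦ.jvp.1 _).hasFDerivAt.comp x₀
          ((restrict P j.1).hasFDerivAt.comp x₀ (hX.differentiable x₀).hasFDerivAt)
      rw [hc.fderiv]
      rfl
    · rw [h4 _ (vec_not_mem_blockRegs h), P.setBlock_of_ne _ _ h]
      exact hσ.tan k hk v hv hSv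
  · rw [h4 r (hr j.1 j.2)]
    exact hσ.frame r hr

end GradAlgo

/-! ### Complete passes, the chain rule for the objective, and correctness of the algorithm -/

namespace GradAlgo

open Code

theorem sum_lowerLevels {M : Type} [AddCommMonoid M] {N : ℕ} (i : Fin (N + 1))
    (h : {j : Fin (N + 1) // i < j} → M) : ((lowerLevels i).map h).sum = ∑ j, h j := by
  classical
  rw [← List.sum_toFinset h (pairwise_lowerLevels i).nodup]
  congr 1
  ext j
  simp [mem_lowerLevels]

theorem sum_eq_add_sum_lower {M : Type} [AddCommMonoid M] {N : ℕ} (i : Fin (N + 1))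
    (h : Fin (N + 1) → M) (h0 : ∀ j, j < i → h j = 0) :
    ∑ j, h j = h i + ∑ j : {j : Fin (N + 1) // i < j}, h j := by
  have h1 : ∑ j : {j : Fin (N + 1) // i < j}, h j = ∑ j ∈ Finset.Ioi i, h j :=
    (Finset.sum_subtype _ (by simp) h).symm
  rw [h1, ← Finset.sum_insert (by simp), Finset.Ioi_insert]
  refine (Finset.sum_subset (Finset.subset_univ _) fun j _ hj => h0 j ?_).symm
  simpa using hj

variable {ρ : ℕ} {L : ElemLib ρ} {N : ℕ} {P : MultilevelProblem N} {b : ℕ}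
  {i : Fin (N + 1)} (A : GradAlgo L P b i)

/-- The values of all variables when the iterations of all levels below `i` are done. -/
noncomputable def trajectory (P : MultilevelProblem N) (i : Fin (N + 1)) (x : CoordLE P.d i → ℝ) :
    Coord P.d → ℝ :=
  (lowerLevels i).foldl (fun x j => P.solveLevel x j.1) (Function.extend Subtype.val x 0)

variable [NeZero b]

/-- The partial folds that define the trajectory serve as the loop invariants. Their
differentiability is carried along, as it needs the programs for `Φ_j^(t)` at each step; that of the
full trajectory comes out as a by-product. -/
theorem loopPass_holds {p : ℕ} {x₀ : CoordLE P.d i → ℝ} {σ₀ : Reg P.d b i → ℝ}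
    (hzero : σ₀ Reg.zero = 0) (hone : σ₀ Reg.one = 1)
    (htop : ∀ v, (h : v.1 ≤ i) → σ₀ (Reg.vec Slot.x v) = x₀ ⟨v, h⟩)
    (hΦ : ∀ j t, t ∈ Finset.Icc 1 (P.T j.1) → (A.phi j t).Computes (P.Φ j.1 t)) :
    (A.loopPass p).Safe σ₀ ∧ IsTrajectory P i (trajectory P i) ∧
      Holds p x₀ σ₀ (fun _ => True) (trajectory P i) ((A.loopPass p).run σ₀) := by
  let X (l : List {j : Fin (N + 1) // i < j}) (x : CoordLE P.d i → ℝ) : Coord P.d → ℝ :=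
    l.foldl (fun x j => P.solveLevel x j.1) (Function.extend Subtype.val x 0)
  have key := Triple.seqs_map (l := lowerLevels i) (f := fun j =>
      Code.seq (init p j) (seqs ((List.range (P.T j.1)).map fun t => A.step p j (t + 1))))
    (fun pre σ => IsTrajectory P i (X pre) ∧
      Holds p x₀ σ₀ (fun m => ∃ j ∈ pre, j.1 = m) (X pre) σ) (by
    rintro pre j suf hl σ ⟨hX, hσ⟩
    -- The levels are visited in increasing order, so all levels on which `Φ_j` depends are valid
    -- once level `j` is initialised.
    have hS : ∀ m, i < m → m ≤ j.1 → (∃ j' ∈ pre, j'.1 = m) ∨ m = j.1 := by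
      intro m hm hmj
      rcases hmj.eq_or_lt with h | h
      · exact Or.inr h
      · have hmem : (⟨m, hm⟩ : {j : Fin (N + 1) // i < j}) ∈ pre ++ j :: suf :=
          hl ▸ mem_lowerLevels _
        have hp : (pre ++ j :: suf).Pairwise (· < ·) := hl ▸ pairwise_lowerLevels i
        rw [List.mem_append, List.mem_cons] at hmem
        rcases hmem with h' | h' | h'
        · exact Or.inl ⟨_, h', rfl⟩
        · exact Or.inr (congrArg Subtype.val h')
        · have := (List.pairwise_cons.1 (List.pairwise_append.1 hp).2.1).1 _ h'
          exact absurd h (not_lt_of_gt this)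
    let Y (l : List ℕ) (x : CoordLE P.d i → ℝ) : Coord P.d → ℝ :=
      l.foldl (fun x t => P.setBlock x j.1 (P.Φ j.1 (t + 1) fun v => x v.1))
        (P.setBlock (X pre x) j.1 fun a => P.x0 ⟨j.1, a⟩)
    have T1 : Triple (fun τ => τ = σ) (init (L := L) p j) (fun τ => IsTrajectory P i (Y []) ∧
        Holds p x₀ σ₀ (fun m => (∃ j' ∈ pre, j'.1 = m) ∨ m = j.1) (Y []) τ) := by
      rintro τ rfl
      exact ⟨(init_holds (L := L) hX j τ hσ).1, hX.setBlock j.2 (differentiable_const _),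
        (init_holds (L := L) hX j τ hσ).2⟩
    have T2 := Triple.seqs_map (l := List.range (P.T j.1)) (f := fun t => A.step p j (t + 1))
      (fun pre' τ => IsTrajectory P i (Y pre') ∧
        Holds p x₀ σ₀ (fun m => (∃ j' ∈ pre, j'.1 = m) ∨ m = j.1) (Y pre') τ) (by
      rintro pre' t suf' hl' τ ⟨hY, hτ⟩
      have ht : t < P.T j.1 := List.mem_range.1 (by simp [← hl'])
      have hc := hΦ j (t + 1) (by simp; omega)
      have e : Y (pre' ++ [t]) = fun x => P.setBlock (Y pre' x) j.1
          (P.Φ j.1 (t + 1) fun v => Y pre' x v.1) := by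
        funext x
        simp [Y]
      have hd : Differentiable ℝ fun x => P.Φ j.1 (t + 1) (restrict P j.1 (Y pre' x)) :=
        hc.jvp.1.comp ((restrict P j.1).differentiable.comp hY.differentiable)
      rw [e]
      have := A.step_holds hzero hone htop hY hS hc τ hτ
      exact ⟨this.1, hY.setBlock j.2 hd, this.2⟩)
    have hfin := T1.seq T2 σ rfl
    have e : X (pre ++ [j]) = Y (List.range (P.T j.1)) := by
      funext x
      simp [X, Y, MultilevelProblem.solveLevel]
    rw [e]
    refine ⟨hfin.1, hfin.2.1, ?_⟩
    convert hfin.2.2 using 2 with m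
    simp [or_and_right, exists_or, eq_comm])
  obtain ⟨h1, h2, h3⟩ := key σ₀ ⟨isTrajectory_extend, by simp, by simp, fun _ _ => rfl⟩
  exact ⟨h1, h2, fun v hv _ => h3.val v hv ⟨⟨v.1, hv⟩, mem_lowerLevels _, rfl⟩,
    fun k hk v hv _ => h3.tan k hk v hv ⟨⟨v.1, hv⟩, mem_lowerLevels _, rfl⟩, h3.frame⟩

omit [NeZero b] in
theorem gradients_spec (hgrad : ∀ j, i ≤ j → (A.gradf j).Computes (P.gradf i j))
    (σ : Reg P.d b i → ℝ) :
    A.gradients.Safe σ ∧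
    (∀ v : Coord P.d, i ≤ v.1 →
      A.gradients.run σ (Reg.vec Slot.grad v) = P.gradf i v.1 (σ ∘ Reg.vec Slot.x) v.2) ∧
    ∀ r, (∀ v, r ≠ Reg.vec Slot.grad v) → A.gradients.run σ r = σ r := by
  set l := i :: (lowerLevels i).map Subtype.val with hl
  have hle : ∀ j ∈ l, i ≤ j := by
    intro j hj
    rcases List.mem_cons.1 hj with rfl | hj
    · exact le_rfl
    · obtain ⟨m, -, rfl⟩ := List.mem_map.1 hj
      exact m.2.le
  have hmem : ∀ j, i ≤ j → j ∈ l := by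
    intro j hj
    rcases hj.eq_or_lt with rfl | h
    · simp [hl]
    · exact List.mem_cons_of_mem _ (List.mem_map.2 ⟨⟨j, h⟩, mem_lowerLevels _, rfl⟩)
  have key := Triple.seqs_map (l := l) (f := fun j =>
      (A.gradf j).call (Reg.vec Slot.x) (Reg.block Slot.grad j))
    (fun pre τ => (∀ v : Coord P.d, v.1 ∈ pre →
        τ (Reg.vec Slot.grad v) = P.gradf i v.1 (σ ∘ Reg.vec Slot.x) v.2) ∧
      ∀ r, (∀ v, r ≠ Reg.vec Slot.grad v) → τ r = σ r) (by
    rintro pre j suf hpre τ ⟨h1, h2⟩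
    obtain ⟨k1, k2, k3⟩ := (hgrad j (hle j (by simp [← hpre]))).call_spec
      (Reg.vec Slot.x) (Reg.block Slot.grad j) τ
    refine ⟨k1, fun v hv => ?_, fun r hr => ?_⟩
    · by_cases h : v.1 = j
      · obtain ⟨m, a⟩ := v
        obtain rfl : m = j := h
        have e : τ ∘ Reg.vec Slot.x = σ ∘ Reg.vec Slot.x :=
          funext fun v => h2 _ fun v' => by simp
        exact (k2 a).trans (by rw [e])
      · rw [k3 _ fun a ha => h (congrArg Sigma.fst (vec_inj.1 ha).2)]
        exact h1 v (by simpa [h] using hv)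
    · rw [k3 _ fun a => hr _]
      exact h2 r hr)
  obtain ⟨h1, h2, h3⟩ := key σ ⟨by simp, fun _ _ => rfl⟩
  exact ⟨h1, fun v hv => h2 v (hmem _ hv), h3⟩

theorem finish_spec (p : ℕ) (σ : Reg P.d b i → ℝ) :
    (finish (L := L) p).Safe σ ∧
    (∀ k ∈ rows b p, (finish (L := L) p).run σ (Reg.g k) =
      σ (Reg.vec Slot.grad ⟨i, k⟩) + σ Reg.zero + ∑ j : {j : Fin (N + 1) // i < j},
        ∑ a, σ (Reg.vec (row k) ⟨j.1, a⟩) * σ (Reg.vec Slot.grad ⟨j.1, a⟩)) ∧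
    ∀ r, r ≠ Reg.tmp → (∀ k ∈ rows b p, r ≠ Reg.g k) → (finish (L := L) p).run σ r = σ r := by
  have hgt : ∀ k : Fin (P.d i), (Reg.g k : Reg P.d b i) ≠ Reg.tmp := by simp [Reg.g, Reg.tmp]
  have hvt : ∀ s v, (Reg.vec s v : Reg P.d b i) ≠ Reg.tmp := by simp [Reg.vec, Reg.tmp]
  have hgz : ∀ k : Fin (P.d i), (Reg.zero : Reg P.d b i) ≠ Reg.g k := by simp [Reg.g, Reg.zero]
  have hzt : (Reg.zero : Reg P.d b i) ≠ Reg.tmp := by simp [Reg.zero, Reg.tmp]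
  have hgg : ∀ k k' : Fin (P.d i), k ≠ k' → (Reg.g k : Reg P.d b i) ≠ Reg.g k' := by
    simp [Reg.g]
  have hvg : ∀ s v (k : Fin (P.d i)), (Reg.vec s v : Reg P.d b i) ≠ Reg.g k := by
    simp [Reg.vec, Reg.g]
  have key := Triple.seqs_map (l := rows b p) (f := fun k : Fin (P.d i) =>
    Code.seq (op L.add (Reg.g k) (Reg.vec Slot.grad ⟨i, k⟩) Reg.zero)
      (seqs ((lowerLevels i).map fun j => seqs ((List.finRange (P.d j.1)).map fun a =>
        Code.seq (op L.mul Reg.tmp (Reg.vec (row k) ⟨j.1, a⟩) (Reg.vec Slot.grad ⟨j.1, a⟩))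
          (op L.add (Reg.g k) (Reg.g k) (Reg.tmp : Reg P.d b i))))))
    (fun pre τ => (∀ k ∈ pre, τ (Reg.g k) =
        σ (Reg.vec Slot.grad ⟨i, k⟩) + σ Reg.zero + ∑ j : {j : Fin (N + 1) // i < j},
          ∑ a, σ (Reg.vec (row k) ⟨j.1, a⟩) * σ (Reg.vec Slot.grad ⟨j.1, a⟩)) ∧
      ∀ r, r ≠ Reg.tmp → (∀ k ∈ pre, r ≠ Reg.g k) → τ r = σ r) (by
    rintro pre k suf hpre τ ⟨h1, h2⟩
    set τ₁ := (op L.add (Reg.g k) (Reg.vec Slot.grad ⟨i, k⟩) Reg.zero).run τ with hτ₁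
    have hτ₁g : τ₁ (Reg.g k) = σ (Reg.vec Slot.grad ⟨i, k⟩) + σ Reg.zero := by
      rw [hτ₁, run_op_self, L.val_add, h2 _ (hvt _ _) fun _ _ => hvg _ _ _,
        h2 _ hzt fun _ _ => hgz _]
    have hτ₁vec : ∀ s v, τ₁ (Reg.vec s v) = σ (Reg.vec s v) := by
      intro s v
      rw [hτ₁, run_op_of_ne (hvg _ _ _), h2 _ (hvt _ _) fun _ _ => hvg _ _ _]
    obtain ⟨k1, k2, k3⟩ := seqs_accumulate (l := lowerLevels i)
      (f := fun j => seqs ((List.finRange (P.d j.1)).map fun a =>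
        Code.seq (op L.mul Reg.tmp (Reg.vec (row k) ⟨j.1, a⟩) (Reg.vec Slot.grad ⟨j.1, a⟩))
          (op L.add (Reg.g k) (Reg.g k) (Reg.tmp : Reg P.d b i))))
      (g := Reg.g k) (t := Reg.tmp) (σ := τ₁) (w := fun j => ((List.finRange (P.d j.1)).map fun a =>
        σ (Reg.vec (row k) ⟨j.1, a⟩) * σ (Reg.vec Slot.grad ⟨j.1, a⟩)).sum) (τ := τ₁) (by
      intro j _ τ' hτ'
      refine seqs_accumulate (σ := τ₁) ?_ hτ'
      intro a _ τ'' hτ''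
      refine ⟨⟨by simp [Safe, L.dom_mul], by simp [Safe, L.dom_add]⟩, ?_, ?_⟩
      · change (op L.add _ _ _).run ((op L.mul _ _ _).run τ'') _ = _
        rw [run_op_self, L.val_add, run_op_self, run_op_of_ne (hgt k), L.val_mul,
          hτ'' _ (hvg _ _ _) (hvt _ _), hτ'' _ (hvg _ _ _) (hvt _ _), hτ₁vec, hτ₁vec]
      · intro r hg ht
        change (op L.add _ _ _).run ((op L.mul _ _ _).run τ'') _ = _
        rw [run_op_of_ne hg, run_op_of_ne ht]) fun _ _ _ => rfl
    refine ⟨⟨by simp [Safe, L.dom_add], k1⟩, fun k' hk' => ?_, fun r hr hr' => ?_⟩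
    · by_cases h : k' = k
      · subst h
        refine k2.trans ?_
        rw [hτ₁g, sum_lowerLevels]
        simp only [Fin.sum_univ_def]
      · refine (k3 _ (hgg _ _ h) (hgt _)).trans ?_
        rw [hτ₁, run_op_of_ne (hgg _ _ h)]
        exact h1 k' (by simpa [h] using hk')
    · have hg := hr' k (by simp)
      refine (k3 r hg hr).trans ?_
      rw [hτ₁, run_op_of_ne hg]
      exact h2 r hr fun k' hk' => hr' k' (by simp [hk']))
  exact key σ ⟨by simp, fun _ _ _ => rfl⟩

omit [NeZero b] in
/-- The chain rule for the approximated objective function. -/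
theorem gradF_eq (hX : IsTrajectory P i (trajectory P i)) (hf : Differentiable ℝ (P.f i))
    (x₀ : CoordLE P.d i → ℝ) (k : Fin (P.d i)) :
    P.gradF i x₀ k = P.gradf i i (trajectory P i x₀) k + ∑ j : {j : Fin (N + 1) // i < j},
      ∑ a, fderiv ℝ (trajectory P i) x₀ (basisVec P i k) ⟨j.1, a⟩ *
        P.gradf i j.1 (trajectory P i x₀) a := by
  classical
  have hc : HasFDerivAt (P.Ftilde i) ((fderiv ℝ (P.f i) (trajectory P i x₀)).comp
      (fderiv ℝ (trajectory P i) x₀)) x₀ :=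
    (hf _).hasFDerivAt.comp x₀ (hX.differentiable x₀).hasFDerivAt
  set u := fderiv ℝ (trajectory P i) x₀ (basisVec P i k) with hu
  have h1 : P.gradF i x₀ k = fderiv ℝ (P.f i) (trajectory P i x₀) u := by
    simp only [MultilevelProblem.gradF, hc.fderiv]
    rfl
  have h2 : fderiv ℝ (P.f i) (trajectory P i x₀) u =
      ∑ v, u v * P.gradf i v.1 (trajectory P i x₀) v.2 := by
    conv_lhs => rw [pi_eq_sum_univ' u]
    rw [map_sum]
    refine Finset.sum_congr rfl fun v _ => ?_
    rw [map_smul, smul_eq_mul, MultilevelProblem.gradf]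
  have h3 : ∀ v : Coord P.d, v.1 ≤ i → v ≠ ⟨i, k⟩ → u v = 0 := by
    intro v hv hne
    rw [hu, hX.fderiv_top _ _ hv, basisVec, Pi.single_eq_of_ne]
    exact fun h => hne (congrArg Subtype.val h)
  have h4 : u ⟨i, k⟩ = 1 := by
    rw [hu, hX.fderiv_top _ _ le_rfl]
    simp [basisVec]
  -- Summed by levels, those above `i` contribute nothing, level `i` leaves the single coordinate
  -- `k`, and the lower ones give the products with `Z_j`.
  rw [h1, h2, Fintype.sum_sigma, sum_eq_add_sum_lower i]
  · congr 1
    rw [Finset.sum_eq_single k, h4, one_mul]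
    · intro a _ ha
      rw [h3 _ le_rfl (by simpa using ha), zero_mul]
    · simp
  · intro j hj
    refine Finset.sum_eq_zero fun a _ => ?_
    rw [h3 _ hj.le, zero_mul]
    intro h
    exact hj.ne (congrArg Sigma.fst h)

theorem finish_gradF (hX : IsTrajectory P i (trajectory P i)) (hf : Differentiable ℝ (P.f i))
    {x₀ : CoordLE P.d i → ℝ} {p : ℕ} {σ : Reg P.d b i → ℝ} (hzero : σ Reg.zero = 0)
    (htan : ∀ k ∈ rows b p, ∀ v : Coord P.d, i < v.1 →
      σ (Reg.vec (row k) v) = fderiv ℝ (trajectory P i) x₀ (basisVec P i k) v)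
    (hgrad : ∀ v : Coord P.d, i ≤ v.1 →
      σ (Reg.vec Slot.grad v) = P.gradf i v.1 (trajectory P i x₀) v.2) :
    ∀ k ∈ rows b p, (finish (L := L) p).run σ (Reg.g k) = P.gradF i x₀ k := by
  intro k hk
  rw [(finish_spec p σ).2.1 k hk, gradF_eq hX hf, hgrad _ le_rfl, hzero, add_zero]
  congr 1
  refine Finset.sum_congr rfl fun j _ => Finset.sum_congr rfl fun a _ => ?_
  rw [htan k hk ⟨j.1, a⟩ j.2, hgrad ⟨j.1, a⟩ j.2.le]

-- The gradients survive all later passes. They may be reused there, because every pass recomputes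
-- the same trajectory values.
omit [NeZero b] in
theorem grad_not_mem_blockRegs {j : Fin (N + 1)} {v : Coord P.d} :
    (Reg.vec Slot.grad v : Reg P.d b i) ∉ blockRegs b i j := by
  rintro ⟨s, a, hs, h⟩
  exact hs (vec_inj.1 h).1.symm

omit [NeZero b] in
theorem g_not_mem_blockRegs {j : Fin (N + 1)} {k : Fin (P.d i)} :
    (Reg.g k : Reg P.d b i) ∉ blockRegs b i j := by
  simp [blockRegs]

/-- The gradient algorithm is correct. -/
theorem toProc_computes (hf : Differentiable ℝ (P.f i))
    (hgrad : ∀ j, i ≤ j → (A.gradf j).Computes (P.gradf i j))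
    (hΦ : ∀ j t, t ∈ Finset.Icc 1 (P.T j.1) → (A.phi j t).Computes (P.Φ j.1 t)) :
    Differentiable ℝ (P.Ftilde i) ∧ A.toProc.Computes (P.gradF i) := by
  -- This fact concerns no state of the machine; it is read off from a pass at an artificial state
  -- that satisfies the requirements.
  have hX : IsTrajectory P i (trajectory P i) := by
    classical
    exact (A.loopPass_holds (p := 0) (x₀ := 0)
      (σ₀ := Function.update 0 Reg.one 1) (by simp [Reg.zero, Reg.one]) (by simp)
      (fun v h => by simp [Reg.vec, Reg.one]) hΦ).2.1
  refine ⟨hf.comp hX.differentiable, fun x₀ => ?_⟩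
  let Good (σ : Reg P.d b i → ℝ) : Prop := σ Reg.zero = 0 ∧ σ Reg.one = 1 ∧
    ∀ v, (h : v.1 ≤ i) → σ (Reg.vec Slot.x v) = x₀ ⟨v, h⟩
  let Grads (σ : Reg P.d b i → ℝ) : Prop := ∀ v : Coord P.d, i ≤ v.1 →
    σ (Reg.vec Slot.grad v) = P.gradf i v.1 (trajectory P i x₀) v.2
  let Tan (p : ℕ) (σ : Reg P.d b i → ℝ) : Prop := ∀ k ∈ rows b p, ∀ v : Coord P.d, i < v.1 →
    σ (Reg.vec (row k) v) = fderiv ℝ (trajectory P i) x₀ (basisVec P i k) v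
  let Done (D : ℕ → Prop) (σ : Reg P.d b i → ℝ) : Prop := ∀ k : Fin (P.d i), D (k.val / b) →
    σ (Reg.g k) = P.gradF i x₀ k
  have hloop : ∀ p (σ₀ : Reg P.d b i → ℝ), Good σ₀ → (A.loopPass p).Safe σ₀ ∧
      Good ((A.loopPass p).run σ₀) ∧ Tan p ((A.loopPass p).run σ₀) ∧
      (∀ v, (A.loopPass p).run σ₀ (Reg.vec Slot.x v) = trajectory P i x₀ v) ∧
      (∀ v, (A.loopPass p).run σ₀ (Reg.vec Slot.grad v) = σ₀ (Reg.vec Slot.grad v)) ∧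
      ∀ k, (A.loopPass p).run σ₀ (Reg.g k) = σ₀ (Reg.g k) := by
    rintro p σ₀ ⟨hzero, hone, htop⟩
    obtain ⟨h1, -, h3⟩ := A.loopPass_holds (p := p) hzero hone htop hΦ
    have htop' : ∀ v, (h : v.1 ≤ i) → (A.loopPass p).run σ₀ (Reg.vec Slot.x v) = x₀ ⟨v, h⟩ :=
      fun v h => (h3.frame _ fun j hj => vec_not_mem_blockRegs (h.trans_lt hj).ne).trans (htop v h)
    refine ⟨h1, ⟨(h3.frame _ fun _ _ => zero_not_mem_blockRegs).trans hzero,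
      (h3.frame _ fun _ _ => one_not_mem_blockRegs).trans hone, htop'⟩,
      fun k hk v hv => h3.tan k hk v hv trivial, fun v => ?_,
      fun v => h3.frame _ fun _ _ => grad_not_mem_blockRegs,
      fun k => h3.frame _ fun _ _ => g_not_mem_blockRegs⟩
    rcases le_or_gt v.1 i with h | h
    · rw [htop' v h, hX.top x₀ v h]
    · exact h3.val v h trivial
  have hfin : ∀ p D, Triple (fun σ => Good σ ∧ Grads σ ∧ Tan p σ ∧ Done D σ)
      (finish (L := L) p) (fun σ => Good σ ∧ Grads σ ∧ Done (fun q => D q ∨ q = p) σ) := by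
    rintro p D σ ⟨⟨hzero, hone, htop⟩, hG, hT, hD⟩
    obtain ⟨h1, -, h3⟩ := finish_spec (L := L) p σ
    refine ⟨h1, ⟨?_, ?_, fun v h => ?_⟩, fun v h => ?_, fun k hk => ?_⟩
    · rw [h3 _ (by simp [Reg.zero, Reg.tmp]) (by simp [Reg.zero, Reg.g]), hzero]
    · rw [h3 _ (by simp [Reg.one, Reg.tmp]) (by simp [Reg.one, Reg.g]), hone]
    · rw [h3 _ (by simp [Reg.vec, Reg.tmp]) (by simp [Reg.vec, Reg.g]), htop v h]
    · rw [h3 _ (by simp [Reg.vec, Reg.tmp]) (by simp [Reg.vec, Reg.g]), hG v h]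
    · by_cases hk' : k ∈ rows b p
      · exact finish_gradF hX hf hzero hT hG k hk'
      · rw [h3 _ (by simp [Reg.g, Reg.tmp]) (by
          rintro k' hk'' h
          have : k = k' := by simpa [Reg.g] using h
          exact hk' (this ▸ hk''))]
        exact hD k (hk.resolve_right fun h => hk' (by simp [rows, h]))
  have T1 : Triple (fun σ => σ = Function.extend (Reg.input i) x₀ 0)
      (op (L.const 1) Reg.one Reg.zero (Reg.zero : Reg P.d b i)) Good := by
    rintro σ rfl
    refine ⟨by simp [Safe, L.dom_const], ?_, ?_, fun v h => ?_⟩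
    · rw [run_op_of_ne (by simp [Reg.zero, Reg.one]), Function.extend_apply']
      · rfl
      · rintro ⟨v, h⟩
        exact zero_ne_vec h.symm
    · rw [run_op_self, L.val_const]
    · rw [run_op_of_ne one_ne_vec.symm]
      exact (Reg.input i).injective.extend_apply x₀ 0 ⟨v, h⟩
  have T2 : Triple Good (A.loopPass 0) (fun σ => Good σ ∧ Tan 0 σ ∧
      ∀ v, σ (Reg.vec Slot.x v) = trajectory P i x₀ v) := fun σ hσ =>
    ⟨(hloop 0 σ hσ).1, (hloop 0 σ hσ).2.1, (hloop 0 σ hσ).2.2.1, (hloop 0 σ hσ).2.2.2.1⟩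
  have T3 : Triple (fun σ => Good σ ∧ Tan 0 σ ∧
      ∀ v, σ (Reg.vec Slot.x v) = trajectory P i x₀ v) A.gradients
      (fun σ => Good σ ∧ Grads σ ∧ Tan 0 σ ∧ Done (fun _ => False) σ) := by
    rintro σ ⟨⟨hzero, hone, htop⟩, hT, hx⟩
    obtain ⟨h1, h2, h3⟩ := A.gradients_spec hgrad σ
    refine ⟨h1, ⟨?_, ?_, fun v h => ?_⟩, fun v h => ?_, fun k hk v hv => ?_, fun k hk => hk.elim⟩
    · rw [h3 _ (by simp), hzero]
    · rw [h3 _ (by simp), hone]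
    · rw [h3 _ (by simp), htop v h]
    · rw [h2 v h]
      congr 1
      exact funext hx
    · rw [h3 _ (by simp), hT k hk v hv]
  have T5 := Triple.seqs_map (l := List.range A.morePasses)
    (f := fun p => Code.seq (A.loopPass (p + 1)) (finish (p + 1)))
    (fun pre σ => Good σ ∧ Grads σ ∧ Done (fun q => (False ∨ q = 0) ∨ ∃ p ∈ pre, q = p + 1) σ) (by
    rintro pre p suf - σ ⟨hσ, hG, hD⟩
    obtain ⟨h1, h2, h3, -, h5, h6⟩ := hloop (p + 1) σ hσ
    obtain ⟨k1, k2, k3, k4⟩ := hfin (p + 1) (fun q => (False ∨ q = 0) ∨ ∃ p ∈ pre, q = p + 1) _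
      ⟨h2, fun v hv => (h5 v).trans (hG v hv), h3, fun k hk => (h6 k).trans (hD k hk)⟩
    refine ⟨⟨h1, k1⟩, k2, k3, fun k hk => k4 k ?_⟩
    rcases hk with hk | ⟨q, hq, e⟩
    · exact Or.inl (Or.inl hk)
    · rcases List.mem_append.1 hq with hq | hq
      · exact Or.inl (Or.inr ⟨q, hq, e⟩)
      · exact Or.inr (by rw [e, List.mem_singleton.1 hq]))
  have T5' : Triple (fun σ => Good σ ∧ Grads σ ∧ Done (fun q => False ∨ q = 0) σ)
      (seqs ((List.range A.morePasses).map fun p => Code.seq (A.loopPass (p + 1)) (finish (p + 1))))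
      (fun σ => ∀ k, σ (Reg.g k) = P.gradF i x₀ k) := by
    rintro σ ⟨hσ, hG, hD⟩
    obtain ⟨h1, -, -, h2⟩ := T5 σ ⟨hσ, hG, fun k hk => hD k (by simpa using hk)⟩
    refine ⟨h1, fun k => h2 k ?_⟩
    -- The largest row index is `d_i - 1`, so its pass number is exactly `morePasses`: no row is
    -- missed.
    have hk : k.val / b ≤ A.morePasses := Nat.div_le_div_right (by omega)
    rcases Nat.eq_zero_or_pos (k.val / b) with h | h
    · exact Or.inl (Or.inr h)
    · exact Or.inr ⟨k.val / b - 1, List.mem_range.2 (by omega), by omega⟩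
  have T := T1.cons (T2.cons (T3.cons ((hfin 0 fun _ => False).cons (T5'.cons Triple.nil)))) _ rfl
  exact ⟨T.1, funext T.2⟩

end GradAlgo

namespace Proc

variable {ρ : ℕ} {L : ElemLib ρ} {α β : Type}

theorem Computes.reindex {α' : Type} {P : Proc L α β} {F : (α → ℝ) → β → ℝ} (h : P.Computes F)
    (e : α' ≃ α) : (P.reindex e).Computes fun x => F (x ∘ e.symm) := by
  intro x
  have he : Function.extend (P.reindex e).inp x 0 = Function.extend P.inp (x ∘ e.symm) 0 := by
    funext r
    by_cases hr : ∃ a, P.inp a = r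
    · obtain ⟨a, rfl⟩ := hr
      rw [P.inp.injective.extend_apply]
      have : P.inp a = (P.reindex e).inp (e.symm a) :=
        congrArg P.inp (e.apply_symm_apply a).symm
      exact this ▸ (P.reindex e).inp.injective.extend_apply x 0 (e.symm a)
    · rw [Function.extend_apply' _ _ _ hr]
      exact Function.extend_apply' _ _ _ fun ⟨a, ha⟩ => hr ⟨e a, ha⟩
  have := h (x ∘ e.symm)
  rw [← he] at this
  refine ⟨this.1, ?_⟩
  change (P.reindex e).eval x = F (x ∘ e.symm)
  rw [← (h (x ∘ e.symm)).2]
  simp only [Proc.eval, ← he]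
  rfl

/-- At the lowest level all variables are inputs, so this bounds their total number by `s_n`. -/
theorem card_le_space [Fintype α] (P : Proc L α β) : Fintype.card α + 1 ≤ P.space := by
  have := Fintype.card_le_of_injective _ P.inp.injective
  unfold Proc.space
  omega

end Proc

namespace GradAlgo

open Code

variable {ρ : ℕ} {L : ElemLib ρ} {N : ℕ} {P : MultilevelProblem N} {b : ℕ}
  {i : Fin (N + 1)} (A : GradAlgo L P b i)

/-! ### Time -/

theorem length_between (j : {j : Fin (N + 1) // i < j}) :
    ((lowerLevels i).filter fun l => l < j).length + 1 ≤ j.1.val - i.val := by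
  classical
  set l := (lowerLevels i).filter fun l => l < j with hl
  have hnd : (l.map Subtype.val).Nodup :=
    ((pairwise_lowerLevels i).nodup.filter _).map Subtype.val_injective
  have hsub : (l.map Subtype.val).toFinset ⊆ Finset.Ioo i j.1 := by
    intro m hm
    obtain ⟨m', hm', rfl⟩ := List.mem_map.1 (List.mem_toFinset.1 hm)
    have : m' < j := by simpa using (List.mem_filter.1 hm').2
    exact Finset.mem_Ioo.2 ⟨m'.2, this⟩
  have h := Finset.card_le_card hsub
  rw [List.toFinset_card_of_nodup hnd, List.length_map, Fin.card_Ioo] at h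
  have : i.val < j.1.val := j.2
  omega

/-- Each row belongs to at most one of the passes. Because of this the time spent on rows does not
depend on `b`. -/
theorem sum_length_rows {m : ℕ} (b M : ℕ) :
    ∑ p ∈ Finset.range M, (rows b p : List (Fin m)).length ≤ m := by
  have : ∀ l : List (Fin m),
      ∑ p ∈ Finset.range M, (l.filter fun k => k.val / b = p).length ≤ l.length := by
    intro l
    induction l with
    | nil => simp
    | cons k l ih =>
      have h : ∀ p, ((k :: l).filter fun k => k.val / b = p).length =
          (l.filter fun k => k.val / b = p).length + if k.val / b = p then 1 else 0 := by
        intro p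
        rw [List.filter_cons]
        split_ifs <;> simp_all
      simp only [h, Finset.sum_add_distrib, List.length_cons, Finset.sum_ite_eq]
      split_ifs <;> omega
  simpa [rows] using this (List.finRange m)

variable [NeZero b]

theorem init_time (p : ℕ) (j : {j : Fin (N + 1) // i < j}) :
    (init (L := L) (P := P) (b := b) p j).time =
      P.d j.1 * (1 + (rows b p : List (Fin (P.d i))).length) := by
  simp [init, time_seqs, time, L.cost_const, Function.comp_def]

/-- There is one product for each of the at most `j - i - 1` levels strictly between, one for level
`i` and one for level `j`. This count is the source of the factorial. -/
theorem updateRow_time_le {j : {j : Fin (N + 1) // i < j}} {t c : ℕ}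
    (hc : (A.phi j t).jvp.time + P.d j.1 ≤ c) (k : Fin (P.d i)) :
    (A.updateRow j t k).time ≤ (j.1.val - i.val + 1) * c := by
  have h := length_between j
  have h1 : (A.updateRow j t k).time = (((lowerLevels i).filter fun l => l < j).length + 2) *
      (A.phi j t).jvp.time +
      (((lowerLevels i).filter fun l => l < j).length + 1) * P.d j.1 := by
    simp only [updateRow, product, time_seqs, List.map_cons, List.map_nil, List.map_map,
      List.sum_cons, List.sum_nil, Proc.call_time, Function.comp_def, time, L.cost_add,
      List.map_const', List.sum_replicate, List.length_finRange, smul_eq_mul]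
    ring
  rw [h1]
  generalize ((lowerLevels i).filter fun l => l < j).length = n at *
  calc (n + 2) * (A.phi j t).jvp.time + (n + 1) * P.d j.1
      ≤ (n + 2) * ((A.phi j t).jvp.time + P.d j.1) := by nlinarith
    _ ≤ (j.1.val - i.val + 1) * c := Nat.mul_le_mul (by omega) hc

/-- The constant in the time bound of one pass of the loops. -/
def passConst (ρ κ : ℕ) : ℕ := (2 * ρ + 4) * κ + κ + 2

/-- The weighted sum of the times of the lower levels. -/
def lowerTime (P : MultilevelProblem N) (i : Fin (N + 1)) (c : Fin (N + 1) → ℕ) : ℕ :=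
  ∑ j : {j : Fin (N + 1) // i < j}, P.T j.1 * ((j.1.val - i.val + 1) * c j.1)

/-- The summand 1 pays for the iterates themselves, which every pass recomputes; each row adds as
much again. The initialisation is absorbed because `T_j ≥ 1`. -/
theorem loopPass_time_le {κ : ℕ} {c : Fin (N + 1) → ℕ} (hT : ∀ j, 0 < j → 1 ≤ P.T j)
    (hd : ∀ j, P.d j ≤ c j)
    (hφ : ∀ j t, t ∈ Finset.Icc 1 (P.T j.1) → (A.phi j t).time ≤ κ * c j.1) (p : ℕ) :
    (A.loopPass p).time ≤ (1 + (rows b p : List (Fin (P.d i))).length) *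
      (passConst ρ κ * lowerTime P i c) := by
  set r := (rows b p : List (Fin (P.d i))).length with hr
  have h1 : (A.loopPass p).time = ∑ j : {j : Fin (N + 1) // i < j}, ((init (L := L) (P := P)
      (b := b) p j).time + ((List.range (P.T j.1)).map fun t => (A.step p j (t + 1)).time).sum) := by
    simp only [loopPass, time_seqs, List.map_map, Function.comp_def, time, sum_lowerLevels]
  rw [h1, lowerTime, Finset.mul_sum, Finset.mul_sum]
  refine Finset.sum_le_sum fun j _ => ?_
  set m := j.1.val - i.val + 1 with hm
  have hstep : ∀ t ∈ List.range (P.T j.1), (A.step p j (t + 1)).time ≤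
      r * (m * (((2 * ρ + 4) * κ + 1) * c j.1)) + κ * c j.1 := by
    intro t ht
    have hφt := hφ j (t + 1) (by simp at ht ⊢; omega)
    have hrow : ∀ k ∈ rows b p, (A.updateRow j (t + 1) k).time ≤
        m * (((2 * ρ + 4) * κ + 1) * c j.1) := fun k _ => A.updateRow_time_le (by
      have := (A.phi j (t + 1)).jvp_time_le
      have := hd j.1
      nlinarith) k
    simp only [step, time, time_seqs, List.map_map, Function.comp_def, Proc.call_time]
    refine add_le_add ?_ hφt
    refine (List.sum_le_card_nsmul _ _ fun x hx => ?_).trans_eq (by rw [List.length_map, smul_eq_mul])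
    obtain ⟨k, hk, rfl⟩ := List.mem_map.1 hx
    exact hrow k hk
  have hsum : ((List.range (P.T j.1)).map fun t => (A.step p j (t + 1)).time).sum ≤
      P.T j.1 * (r * (m * (((2 * ρ + 4) * κ + 1) * c j.1)) + κ * c j.1) := by
    refine (List.sum_le_card_nsmul _ _ fun x hx => ?_).trans_eq
      (by rw [List.length_map, List.length_range, smul_eq_mul])
    obtain ⟨t, ht, rfl⟩ := List.mem_map.1 hx
    exact hstep t ht
  have hTj : 1 ≤ P.T j.1 := hT _ (j.1.zero_le.lt_of_ne fun h => by
    have := j.2; rw [← h] at this; exact absurd this (Fin.not_lt_zero _))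
  have hX : c j.1 ≤ P.T j.1 * (m * c j.1) := by
    calc c j.1 = 1 * (1 * c j.1) := by ring
      _ ≤ _ := Nat.mul_le_mul hTj (Nat.mul_le_mul (by omega) le_rfl)
  have hX2 : c j.1 ≤ m * c j.1 := Nat.le_mul_of_pos_left _ (by omega)
  rw [init_time, ← hr]
  calc P.d j.1 * (1 + r) + _
      ≤ (1 + r) * (P.T j.1 * (m * c j.1)) +
        P.T j.1 * (r * (m * (((2 * ρ + 4) * κ + 1) * c j.1)) + κ * (m * c j.1)) := by
        refine add_le_add ?_ (hsum.trans ?_)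
        · rw [mul_comm]
          exact Nat.mul_le_mul le_rfl ((hd j.1).trans hX)
        · gcongr
    _ ≤ _ := by
        -- In `passConst`, `(2ρ + 4) κ + 1` covers products and additions of a row, `κ` the
        -- evaluation of `Φ_j`, and 1 the initialisation; the last summand is slack.
        have e : (1 + r) * (passConst ρ κ * (P.T j.1 * (m * c j.1))) =
          (1 + r) * (P.T j.1 * (m * c j.1)) +
            P.T j.1 * (r * (m * (((2 * ρ + 4) * κ + 1) * c j.1)) + κ * (m * c j.1)) +
            (r * κ + (2 * ρ + 4) * κ + 1) * (P.T j.1 * (m * c j.1)) := by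
          unfold passConst; ring
        rw [e]
        exact Nat.le_add_right _ _

-- There are at most `d_i` passes and `d_i` rows in total. Small `b` costs only a factor 2 in this
-- bound.
omit [NeZero b] in
theorem sum_passes_le (hdi : 1 ≤ P.d i) :
    ∑ p ∈ Finset.range (A.morePasses + 1), (1 + (rows b p : List (Fin (P.d i))).length) ≤
      2 * P.d i := by
  have h1 := sum_length_rows (m := P.d i) b (A.morePasses + 1)
  have h2 : A.morePasses ≤ P.d i - 1 := Nat.div_le_self _ _
  rw [Finset.sum_add_distrib]
  simp only [Finset.sum_const, Finset.card_range, smul_eq_mul]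
  omega

theorem loops_time : A.loops.time = ∑ p ∈ Finset.range (A.morePasses + 1), (A.loopPass p).time := by
  simp only [loops, time_seqs, List.map_map, Function.comp_def, Finset.sum_range,
    ← List.sum_ofFn]
  rw [List.ofFn_eq_map, ← List.map_coe_finRange_eq_range, List.map_map]
  rfl

theorem loops_time_le {κ : ℕ} {c : Fin (N + 1) → ℕ} (hT : ∀ j, 0 < j → 1 ≤ P.T j)
    (hdi : 1 ≤ P.d i) (hd : ∀ j, P.d j ≤ c j)
    (hφ : ∀ j t, t ∈ Finset.Icc 1 (P.T j.1) → (A.phi j t).time ≤ κ * c j.1) :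
    A.loops.time ≤ 2 * P.d i * (passConst ρ κ * lowerTime P i c) := by
  rw [loops_time]
  calc _ ≤ ∑ p ∈ Finset.range (A.morePasses + 1), (1 + (rows b p : List (Fin (P.d i))).length) *
      (passConst ρ κ * lowerTime P i c) :=
        Finset.sum_le_sum fun p _ => A.loopPass_time_le hT hd hφ p
    _ ≤ _ := by
        rw [← Finset.sum_mul]
        exact Nat.mul_le_mul (A.sum_passes_le hdi) le_rfl

theorem finish_time (p : ℕ) : (finish (L := L) (P := P) (b := b) (i := i) p).time =
    (rows b p : List (Fin (P.d i))).length *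
      (1 + ∑ j : {j : Fin (N + 1) // i < j}, P.d j.1 * 2) := by
  simp only [finish, time_seqs, List.map_map, Function.comp_def, time, L.cost_add, L.cost_mul,
    sum_lowerLevels, List.map_const', List.sum_replicate, List.length_finRange, smul_eq_mul]

omit [NeZero b] in
theorem gradients_time : A.gradients.time = ∑ j ∈ Finset.Ici i, (A.gradf j).time := by
  simp only [gradients, time_seqs, List.map_map, Function.comp_def, List.map_cons, List.sum_cons,
    Proc.call_time, sum_lowerLevels]
  rw [← Finset.Ioi_insert, Finset.sum_insert (by simp)]
  congr 1
  exact (Finset.sum_subtype _ (by simp) fun j => (A.gradf j).time).symm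

theorem toProc_time : A.toProc.time = 1 + Fintype.card (CoordLE P.d i) +
    (1 + A.loops.time + A.gradients.time +
      ∑ p ∈ Finset.range (A.morePasses + 1), (finish (L := L) (P := P) (b := b) (i := i) p).time) +
      P.d i := by
  have h : ((List.range A.morePasses).map fun p =>
      (Code.seq (A.loopPass (p + 1)) (finish (p + 1))).time).sum =
      ∑ p ∈ Finset.range A.morePasses, ((A.loopPass (p + 1)).time +
        (finish (L := L) (P := P) (b := b) (i := i) (p + 1)).time) := by
    rw [Finset.sum_range, ← List.sum_ofFn, List.ofFn_eq_map, ← List.map_coe_finRange_eq_range,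
      List.map_map]
    rfl
  rw [loops_time, Finset.sum_range_succ', Finset.sum_range_succ']
  simp only [Proc.time, toProc, time_seqs, List.map_cons, List.map_nil, List.sum_cons,
    List.sum_nil, List.map_map, Function.comp_def, Fintype.card_fin]
  rw [h, Finset.sum_add_distrib]
  simp only [time, L.cost_const]
  ring

theorem toProc_time_le {κ : ℕ} {c : Fin (N + 1) → ℕ} (hi : i < Fin.last N)
    (hT : ∀ j, 0 < j → 1 ≤ P.T j) (hd1 : ∀ j, 1 ≤ P.d j)
    (hd : ∀ j, Fintype.card (CoordLE P.d j) + P.d j ≤ c j)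
    (hφ : ∀ j t, t ∈ Finset.Icc 1 (P.T j.1) → (A.phi j t).time ≤ κ * c j.1)
    (hg : ∑ j ∈ Finset.Ici i, (A.gradf j).time ≤ κ * A.loopTime) :
    A.toProc.time ≤ (7 + 2 * (1 + κ) * passConst ρ κ) * (P.d i * lowerTime P i c) := by
  set S := lowerTime P i c with hS
  have hd' : ∀ j, P.d j ≤ c j := fun j => (Nat.le_add_left _ _).trans (hd j)
  have hloops := A.loops_time_le hT (hd1 i) hd' hφ
  have hterm : ∀ j : {j : Fin (N + 1) // i < j},
      c j.1 ≤ P.T j.1 * ((j.1.val - i.val + 1) * c j.1) := by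
    intro j
    have hTj : 1 ≤ P.T j.1 := hT _ (lt_of_le_of_lt (Fin.zero_le i) j.2)
    calc c j.1 = 1 * (1 * c j.1) := by ring
      _ ≤ _ := Nat.mul_le_mul hTj (Nat.mul_le_mul (by omega) le_rfl)
  have hsumd : ∑ j : {j : Fin (N + 1) // i < j}, P.d j.1 * 2 ≤ 2 * S := by
    rw [← Finset.sum_mul, mul_comm]
    exact Nat.mul_le_mul le_rfl (Finset.sum_le_sum fun j _ => (hd' j.1).trans (hterm j))
  have hcard : Fintype.card (CoordLE P.d i) ≤ c (Fin.last N) := by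
    refine le_trans ?_ ((Nat.le_add_right _ _).trans (hd (Fin.last N)))
    exact Fintype.card_le_of_injective (fun v => ⟨v.1, Fin.le_last _⟩) fun v v' h => by
      simpa [Subtype.ext_iff] using h
  have hlast : c (Fin.last N) ≤ S :=
    (hterm ⟨_, hi⟩).trans (Finset.single_le_sum (f := fun j : {j : Fin (N + 1) // i < j} =>
      P.T j.1 * ((j.1.val - i.val + 1) * c j.1)) (fun _ _ => Nat.zero_le _) (Finset.mem_univ _))
  have hS1 : 1 ≤ S := ((hd1 (Fin.last N)).trans (hd' _)).trans hlast
  have hfin : ∑ p ∈ Finset.range (A.morePasses + 1),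
      (finish (L := L) (P := P) (b := b) (i := i) p).time ≤ P.d i * (3 * S) := by
    simp only [finish_time]
    rw [← Finset.sum_mul]
    exact Nat.mul_le_mul (sum_length_rows b _) (by omega)
  have hdS : S ≤ P.d i * S := Nat.le_mul_of_pos_left _ (hd1 i)
  have hdd : P.d i ≤ P.d i * S := Nat.le_mul_of_pos_right _ hS1
  have hgr : A.gradients.time ≤ κ * A.loops.time := A.gradients_time.trans_le hg
  rw [toProc_time]
  calc _ ≤ 1 + Fintype.card (CoordLE P.d i) + (1 + (1 + κ) * A.loops.time + P.d i * (3 * S)) +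
        P.d i := by linarith
    _ ≤ 1 + S + (1 + (1 + κ) * (2 * P.d i * (passConst ρ κ * S)) + P.d i * (3 * S)) + P.d i := by
        have := hcard.trans hlast
        gcongr
    _ ≤ _ := by
        -- The 7 counts terms of size at most `d_i S`: two units, the arguments, the results, and
        -- three for the final sums. The factor `1 + κ` accounts for loops and gradients.
        have e : (7 + 2 * (1 + κ) * passConst ρ κ) * (P.d i * S) =
          7 * (P.d i * S) + (1 + κ) * (2 * P.d i * (passConst ρ κ * S)) := by ring
        have e' : P.d i * (3 * S) = 3 * (P.d i * S) := by ring
        rw [e, e']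
        omega

/-! ### Space -/

omit [NeZero b] in
theorem card_reg_le : Fintype.card (Reg P.d b i) ≤
    (b + 5) * Fintype.card (Coord P.d) + (P.d i + 3) := by
  have h : Fintype.card (Slot b) ≤ b + 5 := by
    refine (Fintype.card_le_of_injective (β := Fin b ⊕ Fin 5)
      (fun s => match s with
        | Slot.x => Sum.inr 0
        | Slot.y => Sum.inr 1
        | Slot.w => Sum.inr 2
        | Slot.bbar => Sum.inr 3
        | Slot.grad => Sum.inr 4
        | Slot.z r => Sum.inl r) ?_).trans (by simp)
    intro s s' hs
    cases s <;> cases s' <;> simp_all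
  rw [Fintype.card_sum, Fintype.card_sum, Fintype.card_prod, Fintype.card_fin, Fintype.card_fin]
  gcongr

/-- Memory is released after each call, so the peak is that of a single differentiated `Φ_j`. -/
theorem loopPass_space_le {B : ℕ}
    (hφ : ∀ j t, t ∈ Finset.Icc 1 (P.T j.1) → (A.phi j t).space ≤ B) (p : ℕ) :
    (A.loopPass p).space ≤ 3 * B := by
  refine space_seqs_le fun c hc => ?_
  obtain ⟨j, -, rfl⟩ := List.mem_map.1 hc
  refine max_le (space_seqs_le fun c hc => ?_) (space_seqs_le fun c hc => ?_)
  · obtain ⟨a, -, rfl⟩ := List.mem_map.1 hc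
    refine max_le (Nat.zero_le _) (space_seqs_le fun c hc => ?_)
    obtain ⟨k, -, rfl⟩ := List.mem_map.1 hc
    exact Nat.zero_le _
  · obtain ⟨t, ht, rfl⟩ := List.mem_map.1 hc
    have hB := hφ j (t + 1) (by simp at ht ⊢; omega)
    have hJ : (A.phi j (t + 1)).jvp.space ≤ 3 * B :=
      (Proc.jvp_space_le _).trans (Nat.mul_le_mul le_rfl hB)
    have hadd : ∀ f : Fin (P.d j.1) → Reg P.d b i × Reg P.d b i × Reg P.d b i,
        (seqs ((List.finRange (P.d j.1)).map fun a =>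
          op L.add (f a).1 (f a).2.1 (f a).2.2)).space ≤ 3 * B := fun f =>
      space_seqs_le fun c hc => by
        obtain ⟨a, -, rfl⟩ := List.mem_map.1 hc
        exact Nat.zero_le _
    refine max_le (space_seqs_le fun c hc => ?_) (hB.trans (by omega))
    obtain ⟨k, -, rfl⟩ := List.mem_map.1 hc
    refine space_seqs_le fun c hc => ?_
    simp only [List.mem_cons, List.not_mem_nil, or_false] at hc
    rcases hc with rfl | rfl | rfl | rfl
    · exact hJ
    · refine space_seqs_le fun c hc => ?_
      obtain ⟨l, -, rfl⟩ := List.mem_map.1 hc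
      exact max_le hJ (hadd fun a => (Reg.vec Slot.bbar ⟨j.1, a⟩, Reg.vec Slot.bbar ⟨j.1, a⟩,
        Reg.vec Slot.w ⟨j.1, a⟩))
    · exact hJ
    · exact hadd fun a => (Reg.vec (row k) ⟨j.1, a⟩, Reg.vec Slot.w ⟨j.1, a⟩,
        Reg.vec Slot.bbar ⟨j.1, a⟩)

theorem finish_space (p : ℕ) : (finish (L := L) (P := P) (b := b) (i := i) p).space ≤ 0 := by
  refine space_seqs_le fun c hc => ?_
  obtain ⟨k, -, rfl⟩ := List.mem_map.1 hc
  refine max_le le_rfl (space_seqs_le fun c hc => ?_)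
  obtain ⟨j, -, rfl⟩ := List.mem_map.1 hc
  refine space_seqs_le fun c hc => ?_
  obtain ⟨a, -, rfl⟩ := List.mem_map.1 hc
  exact le_rfl

theorem toProc_space_le {κ S : ℕ}
    (hφ : ∀ j t, t ∈ Finset.Icc 1 (P.T j.1) → (A.phi j t).space ≤ κ * S)
    (hg : ∀ j, i ≤ j → (A.gradf j).space ≤ κ * A.loopSpace) :
    A.toProc.space ≤ (1 + κ) * (Fintype.card (Reg P.d b i) + 1 + 3 * (κ * S)) := by
  have hpass := A.loopPass_space_le hφ
  have hloops : A.loopSpace ≤ Fintype.card (Reg P.d b i) + 1 + 3 * (κ * S) := by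
    refine Nat.add_le_add_left (space_seqs_le fun c hc => ?_) _
    obtain ⟨p, -, rfl⟩ := List.mem_map.1 hc
    exact hpass p
  set R := Fintype.card (Reg P.d b i) + 1 with hR
  have hgr : A.gradients.space ≤ κ * (R + 3 * (κ * S)) := by
    refine space_seqs_le fun c hc => ?_
    obtain ⟨j, hj, rfl⟩ := List.mem_map.1 hc
    refine (hg j ?_).trans (Nat.mul_le_mul le_rfl hloops)
    rcases List.mem_cons.1 hj with rfl | hj
    · exact le_rfl
    · obtain ⟨m, -, rfl⟩ := List.mem_map.1 hj
      exact m.2.le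
  have hbody : A.toProc.body.space ≤ max (3 * (κ * S)) (κ * (R + 3 * (κ * S))) := by
    refine max_le (Nat.zero_le _) (max_le ((hpass 0).trans (le_max_left _ _))
      (max_le (hgr.trans (le_max_right _ _)) (max_le ((finish_space 0).trans (Nat.zero_le _))
        (max_le (space_seqs_le fun c hc => ?_) (Nat.zero_le _)))))
    obtain ⟨p, -, rfl⟩ := List.mem_map.1 hc
    exact max_le ((hpass _).trans (le_max_left _ _)) ((finish_space _).trans (Nat.zero_le _))
  have h : A.toProc.space = R + A.toProc.body.space := rfl
  rw [h]
  have e : (1 + κ) * (R + 3 * (κ * S)) = R + 3 * (κ * S) + κ * (R + 3 * (κ * S)) := by ring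
  rw [e]
  have := max_le_add_of_nonneg (Nat.zero_le (3 * (κ * S))) (Nat.zero_le (κ * (R + 3 * (κ * S))))
  omega

end GradAlgo

/-! ### Induction over the levels -/

namespace Programs

variable {ρ : ℕ} {L : ElemLib ρ} {N : ℕ} {P : MultilevelProblem N} (I : Programs L P.d) (b : ℕ)
  [NeZero b]

theorem gradProc_last : I.gradProc b (Fin.last N) = (I.gradf (Fin.last N) (Fin.last N)).reindex
    (Equiv.subtypeUnivEquiv fun v => Fin.le_last v.1) := by
  rw [gradProc, dif_pos rfl]

theorem gradProc_of_ne {i : Fin (N + 1)} (h : i ≠ Fin.last N) :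
    I.gradProc b i = (I.algo b i).toProc := by
  rw [gradProc, dif_neg h]
  rfl

/-- The induction assumes all lower levels at once, because level `i` calls the update procedures of
every `j > i`. At the lowest level there are no iterations and only the input coordinates are
renamed. -/
theorem gradProc_computes (hf : ∀ i, Differentiable ℝ (P.f i))
    (hg : ∀ i j, i ≤ j → (I.gradf i j).Computes (P.gradf i j))
    (hu : ∀ j, 0 < j → ∀ t ∈ Finset.Icc 1 (P.T j), ∀ G : Proc L (CoordLE P.d j) (Fin (P.d j)),
      G.Computes (P.gradF j) → (I.upd j t G).Computes (P.Φ j t)) (i : Fin (N + 1)) :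
    Differentiable ℝ (P.Ftilde i) ∧ (I.gradProc b i).Computes (P.gradF i) := by
  induction i using (wellFounded_gt (α := Fin (N + 1))).induction with
  | _ i ih =>
    by_cases hi : i = Fin.last N
    · subst hi
      have hnil : lowerLevels (Fin.last N) = [] :=
        List.eq_nil_iff_forall_not_mem.2 fun j _ => absurd j.2 (Fin.le_last _).not_gt
      have htr : GradAlgo.trajectory P (Fin.last N) =
          fun x => (Function.extend Subtype.val x 0 : Coord P.d → ℝ) := by
        funext x
        rw [GradAlgo.trajectory, hnil]
        rfl
      have hX : GradAlgo.IsTrajectory P (Fin.last N) (GradAlgo.trajectory P (Fin.last N)) :=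
        htr ▸ GradAlgo.isTrajectory_extend
      refine ⟨(hf _).comp hX.differentiable, ?_⟩
      rw [gradProc_last]
      convert (hg _ _ le_rfl).reindex (Equiv.subtypeUnivEquiv
        fun v : Coord P.d => Fin.le_last v.1) using 1
      funext x k
      rw [GradAlgo.gradF_eq hX (hf _)]
      have : IsEmpty {j : Fin (N + 1) // Fin.last N < j} := ⟨fun j => absurd j.2 (Fin.le_last _).not_gt⟩
      rw [Finset.univ_eq_empty, Finset.sum_empty, add_zero]
      congr 1
      funext v
      exact hX.top x v (Fin.le_last _)
    · rw [gradProc_of_ne I b hi]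
      exact (I.algo b i).toProc_computes (hf i) (hg i) fun j t ht =>
        hu j.1 ((Fin.zero_le i).trans_lt j.2) t ht _ (ih j.1 j.2).2

/-- The factor `b` of the callee's bound is already present, and the new frame is itself at most `7
b` times a term without `b`. The two add, so `b` is not multiplied in again. -/
theorem gradProc_space_le {κ q : ℕ} (hq : (1 + κ) * (7 + 3 * κ) ≤ q)
    (hφ : ∀ j, 0 < j → ∀ t ∈ Finset.Icc 1 (P.T j),
      (I.phi b j t).space ≤ κ * (I.gradProc b j).space)
    (hg : ∀ i, i < Fin.last N → ∀ j, i ≤ j → (I.gradf i j).space ≤ κ * (I.algo b i).loopSpace)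
    (i : Fin (N + 1)) :
    (I.gradProc b i).space ≤ b * (q ^ (N - i.val) * (I.gradProc b (Fin.last N)).space) := by
  have hb : 1 ≤ b := Nat.one_le_iff_ne_zero.2 (NeZero.ne b)
  have hq1 : 1 ≤ q := le_trans (by nlinarith) hq
  set s := (I.gradProc b (Fin.last N)).space with hs
  have hD : Fintype.card (Coord P.d) + 1 ≤ s := by
    have h1 := (I.gradProc b (Fin.last N)).card_le_space
    have h2 : Fintype.card (Coord P.d) ≤ Fintype.card (CoordLE P.d (Fin.last N)) :=
      Fintype.card_le_of_injective (fun v => ⟨v, Fin.le_last _⟩) fun v v' h => by simpa using h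
    omega
  induction i using (wellFounded_gt (α := Fin (N + 1))).induction with
  | _ i ih =>
    by_cases hi : i = Fin.last N
    · subst hi
      simpa using Nat.le_mul_of_pos_left s hb
    · have hlt : i < Fin.last N := lt_of_le_of_ne (Fin.le_last i) hi
      have hiN : i.val < N := hlt
      set m := N - i.val - 1 with hm
      have hNm : N - i.val = m + 1 := by omega
      have hS : ∀ j : {j : Fin (N + 1) // i < j}, (I.gradProc b j.1).space ≤ b * (q ^ m * s) := by
        intro j
        refine (ih j.1 j.2).trans ?_
        have : i.val < j.1.val := j.2
        exact Nat.mul_le_mul le_rfl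
          (Nat.mul_le_mul (Nat.pow_le_pow_right hq1 (by omega)) le_rfl)
      have h := (I.algo b i).toProc_space_le (κ := κ) (S := b * (q ^ m * s)) (fun j t ht =>
        (hφ j.1 ((Fin.zero_le i).trans_lt j.2) t ht).trans (Nat.mul_le_mul le_rfl (hS j)))
        (hg i hlt)
      have hdi : P.d i ≤ Fintype.card (Coord P.d) := by
        simpa using Fintype.card_le_of_injective (fun a : Fin (P.d i) => (⟨i, a⟩ : Coord P.d))
          fun a a' h => by simpa using h
      -- The `b + 5` vectors, the result and the remaining cells fit into `(b + 6) (D + 1)` with `D`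
      -- the total dimension, and `b + 6 ≤ 7 b`.
      have hR : Fintype.card (Reg P.d b i) + 1 ≤ 7 * (b * (q ^ m * s)) := by
        have h1 : s ≤ q ^ m * s := Nat.le_mul_of_pos_left _ (Nat.pow_pos hq1)
        calc _ ≤ (b + 5) * Fintype.card (Coord P.d) + (P.d i + 3) + 1 :=
              Nat.add_le_add_right GradAlgo.card_reg_le 1
          _ ≤ (b + 6) * (Fintype.card (Coord P.d) + 1) := by nlinarith
          _ ≤ (7 * b) * (q ^ m * s) := Nat.mul_le_mul (by omega) (hD.trans h1)
          _ = _ := by ring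
      rw [gradProc_of_ne I b hi, hNm]
      calc _ ≤ (1 + κ) * (7 * (b * (q ^ m * s)) + 3 * (κ * (b * (q ^ m * s)))) :=
            h.trans (by gcongr)
        _ = (1 + κ) * (7 + 3 * κ) * (b * (q ^ m * s)) := by ring
        _ ≤ q * (b * (q ^ m * s)) := Nat.mul_le_mul hq le_rfl
        _ = _ := by ring

/-- This lets the sum over all lower levels cost no more than one power of `p`, without an extra
factor for their number. -/
theorem mul_geomSum_le {C p : ℕ} (h : C + 1 ≤ p) (m : ℕ) :
    C * ∑ u ∈ Finset.range m, p ^ u ≤ p ^ m := by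
  induction m with
  | zero => simp
  | succ m ih =>
    rw [Finset.sum_range_succ, mul_add, pow_succ']
    nlinarith [Nat.mul_le_mul_right (p ^ m) h]

/-- The product of `w k` over the levels `k` from `i` on. -/
def prodFrom (w : Fin N → ℕ) (i : Fin (N + 1)) : ℕ :=
  ∏ k ∈ Finset.univ.filter fun k : Fin N => i ≤ k.castSucc, w k

theorem mul_prodFrom_le {w : Fin N → ℕ} (hw : ∀ k, 1 ≤ w k) {i j : Fin (N + 1)} {k : Fin N}
    (hik : i ≤ k.castSucc) (hkj : k.castSucc < j) : w k * prodFrom w j ≤ prodFrom w i := by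
  unfold prodFrom
  rw [← Finset.prod_insert (by simpa using hkj)]
  refine Finset.prod_le_prod_of_subset_of_one_le' ?_ fun k _ _ => hw k
  intro k' hk'
  rcases Finset.mem_insert.1 hk' with rfl | h
  · simpa using hik
  · simpa using (hik.trans hkj.le).trans (by simpa using h)

/-- With `m = N - i` and `u = N - j` the first factor is the weight `j - i + 1` of the recursion. It
is at most `m + 1`, and `(u + 1)!` is at most `m!`. -/
theorem mul_factorial_le {m u : ℕ} (h : u < m) :
    (m - u + 1) * (u + 1).factorial ≤ (m + 1).factorial := by
  rw [Nat.factorial_succ m]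
  exact Nat.mul_le_mul (by omega) (Nat.factorial_le h)

/-- Every term of the recursion for `c_i` is bounded by the same factorial and product, with only
the power of `p` depending on `j`; the geometric sum then finishes. -/
theorem gradProc_time_le {κ p : ℕ}
    (hp : 7 + 2 * (1 + κ) * GradAlgo.passConst ρ κ + 1 ≤ p)
    (hd : ∀ i, 1 ≤ P.d i) (hT : ∀ j, 0 < j → 1 ≤ P.T j)
    (hφ : ∀ j, 0 < j → ∀ t ∈ Finset.Icc 1 (P.T j),
      (I.phi b j t).time ≤ κ * (I.gradProc b j).time)
    (hg : ∀ i, i < Fin.last N →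
      ∑ j ∈ Finset.Ici i, (I.gradf i j).time ≤ κ * (I.algo b i).loopTime)
    (i : Fin (N + 1)) :
    (I.gradProc b i).time ≤ p ^ (N - i.val) * (N - i.val + 1).factorial *
      (prodFrom (fun k => P.T k.succ) i * prodFrom (fun k => P.d k.castSucc) i) *
        (I.gradProc b (Fin.last N)).time := by
  set C := 7 + 2 * (1 + κ) * GradAlgo.passConst ρ κ with hC
  have hT' : ∀ k : Fin N, 1 ≤ P.T k.succ := fun k => hT _ (Fin.succ_pos k)
  have hd' : ∀ k : Fin N, 1 ≤ P.d k.castSucc := fun k => hd _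
  set c := (I.gradProc b (Fin.last N)).time with hc
  induction i using (wellFounded_gt (α := Fin (N + 1))).induction with
  | _ i ih =>
    by_cases hi : i = Fin.last N
    · subst hi
      have h : ∀ w : Fin N → ℕ, prodFrom w (Fin.last N) = 1 := by
        intro w
        refine Finset.prod_eq_one fun k hk => ?_
        exact absurd (Finset.mem_filter.1 hk).2 (Fin.castSucc_lt_last k).not_ge
      simpa [h] using hc.ge
    · have hlt : i < Fin.last N := lt_of_le_of_ne (Fin.le_last i) hi
      have hiN : i.val < N := hlt
      set m := N - i.val with hm
      set W := prodFrom (fun k => P.T k.succ) i * prodFrom (fun k => P.d k.castSucc) i with hW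
      have h := (I.algo b i).toProc_time_le (κ := κ) (c := fun j => (I.gradProc b j).time) hlt hT hd
        (fun j => by
          simp only [Proc.time, Fintype.card_fin]
          omega)
        (fun j t ht => hφ j.1 ((Fin.zero_le i).trans_lt j.2) t ht) (hg i hlt)
      have hterm : ∀ j : {j : Fin (N + 1) // i < j},
          P.d i * (P.T j.1 * ((j.1.val - i.val + 1) * (I.gradProc b j.1).time)) ≤
            p ^ (N - j.1.val) * ((m + 1).factorial * W * c) := by
        intro j
        have hij : i.val < j.1.val := j.2
        have hjN := j.1.isLt
        have hTj : P.T j.1 * prodFrom (fun k => P.T k.succ) j.1 ≤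
            prodFrom (fun k => P.T k.succ) i := by
          have hj0 : j.1 ≠ 0 := fun h => by simp [h] at hij
          -- The factors are shifted by one, `w k = T (k + 1)`, so `T_j` is the factor with index `j
          -- - 1`, which lies in `[i, j)`.
          have := mul_prodFrom_le hT' (i := i) (j := j.1) (k := j.1.pred hj0)
            (by rw [Fin.le_def, Fin.val_castSucc, Fin.val_pred]; omega)
            (by rw [Fin.lt_def, Fin.val_castSucc, Fin.val_pred]; omega)
          simpa using this
        have hdj : P.d i * prodFrom (fun k => P.d k.castSucc) j.1 ≤
            prodFrom (fun k => P.d k.castSucc) i := by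
          have := mul_prodFrom_le hd' (i := i) (j := j.1) (k := ⟨i.val, hiN⟩)
            le_rfl j.2
          simpa using this
        have hfac := mul_factorial_le (m := m) (u := N - j.1.val) (by omega)
        have e : m - (N - j.1.val) + 1 = j.1.val - i.val + 1 := by omega
        rw [e] at hfac
        calc _ ≤ P.d i * (P.T j.1 * ((j.1.val - i.val + 1) *
              (p ^ (N - j.1.val) * (N - j.1.val + 1).factorial *
                (prodFrom (fun k => P.T k.succ) j.1 * prodFrom (fun k => P.d k.castSucc) j.1) *
                  c))) := by
              gcongr
              exact ih j.1 j.2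
          _ = p ^ (N - j.1.val) * (((j.1.val - i.val + 1) * (N - j.1.val + 1).factorial) *
              ((P.T j.1 * prodFrom (fun k => P.T k.succ) j.1) *
                (P.d i * prodFrom (fun k => P.d k.castSucc) j.1)) * c) := by ring
          _ ≤ _ := by
              rw [hW]
              gcongr
      have hgeom : ∑ j : {j : Fin (N + 1) // i < j}, p ^ (N - j.1.val) ≤
          ∑ u ∈ Finset.range m, p ^ u := by
        classical
        rw [← Finset.sum_image (s := Finset.univ)
          (g := fun j : {j : Fin (N + 1) // i < j} => N - j.1.val) (f := fun u => p ^ u)]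
        · refine Finset.sum_le_sum_of_subset ?_
          intro u hu
          obtain ⟨j, -, rfl⟩ := Finset.mem_image.1 hu
          have hij : i.val < j.1.val := j.2
          have hjN := j.1.isLt
          exact Finset.mem_range.2 (by omega)
        · intro j _ j' _ h
          have h1 := j.1.isLt
          have h2 := j'.1.isLt
          have h' : N - j.1.val = N - j'.1.val := h
          exact Subtype.ext (Fin.ext (by omega))
      rw [gradProc_of_ne I b hi]
      calc _ ≤ C * ∑ j : {j : Fin (N + 1) // i < j},
            P.d i * (P.T j.1 * ((j.1.val - i.val + 1) * (I.gradProc b j.1).time)) := by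
            rw [← Finset.mul_sum]
            exact h
        _ ≤ C * ∑ j : {j : Fin (N + 1) // i < j},
            p ^ (N - j.1.val) * ((m + 1).factorial * W * c) :=
            Nat.mul_le_mul le_rfl (Finset.sum_le_sum fun j _ => hterm j)
        _ = (C * ∑ j : {j : Fin (N + 1) // i < j}, p ^ (N - j.1.val)) *
            ((m + 1).factorial * W * c) := by
            rw [← Finset.sum_mul]
            exact (mul_assoc _ _ _).symm
        _ ≤ p ^ m * ((m + 1).factorial * W * c) :=
            Nat.mul_le_mul ((Nat.mul_le_mul le_rfl hgeom).trans (mul_geomSum_le hp m)) le_rfl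
        _ = _ := by ring

end Programs

/-! ### Choice of the constants and the final bounds -/

theorem nestedO_eq (K m v : ℕ) : nestedO K m v = K ^ m * v := by
  unfold nestedO
  induction m with
  | zero => simp
  | succ m ih => rw [Function.iterate_succ_apply', ih]; ring

theorem mainTheorem5 (ρ κ : ℕ) :
    ∃ K p q : ℕ, 1 < p ∧ 1 < q ∧
      ∀ (L : ElemLib ρ) (N : ℕ) (P : MultilevelProblem N) (I : Programs L P.d) (b : ℕ) [NeZero b],
        -- there are `n = N + 1 ≥ 2` levels
        1 ≤ N → (∀ i, 1 ≤ P.d i) → (∀ j, 0 < j → 1 ≤ P.T j) →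
        -- the programs do what they should
        (∀ i, Differentiable ℝ (P.f i)) →
        (∀ i j, i ≤ j → (I.gradf i j).Computes (P.gradf i j)) →
        (∀ j, 0 < j → ∀ t ∈ Finset.Icc 1 (P.T j), ∀ G : Proc L (CoordLE P.d j) (Fin (P.d j)),
          G.Computes (P.gradF j) → (I.upd j t G).Computes (P.Φ j t)) →
        -- evaluating `Φ j t` takes time `O(c j)` and space `O(s j)`
        (∀ j, 0 < j → ∀ t ∈ Finset.Icc 1 (P.T j),
          (I.phi b j t).time ≤ κ * (I.gradProc b j).time ∧
          (I.phi b j t).space ≤ κ * (I.gradProc b j).space) →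
        -- evaluating the gradients of `f i` is dominated by the loops of the algorithm
        (∀ i, i < Fin.last N →
          ∑ j ∈ Finset.Ici i, (I.gradf i j).time ≤ κ * (I.algo b i).loopTime ∧
          ∀ j, i ≤ j → (I.gradf i j).space ≤ κ * (I.algo b i).loopSpace) →
        -- the algorithm computes the gradient
        Differentiable ℝ (P.Ftilde 0) ∧ (I.gradProc b 0).Computes (P.gradF 0) ∧
        -- its complexity, with nested `O`
        (I.gradProc b 0).time ≤
          K * (nestedO K (2 * (N + 1) - 3) (I.gradProc b (Fin.last N)).time * (N + 1).factorial *
            ∏ i : Fin N, P.T i.succ * P.d i.castSucc) ∧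
        (I.gradProc b 0).space ≤
          b * nestedO K (2 * (N + 1) - 2) (I.gradProc b (Fin.last N)).space ∧
        -- its complexity, with exponential factors
        (I.gradProc b 0).time ≤
          K * (p ^ (N + 1) * (I.gradProc b (Fin.last N)).time * (N + 1).factorial *
            ∏ i : Fin N, P.T i.succ * P.d i.castSucc) ∧
        (I.gradProc b 0).space ≤
          K * (b * (q ^ (N + 1) * (I.gradProc b (Fin.last N)).space)) := by

  -- The sum of the constants required for time and for space serves as `K`, `p` and `q` at once.
  -- Both inductions give `A ^ N`, one power per level above the lowest, and all four bounds only
  -- enlarge this exponent.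
  set A := 7 + 2 * (1 + κ) * GradAlgo.passConst ρ κ + 1 + (1 + κ) * (7 + 3 * κ) with hA
  have hA1 : 1 < A := by omega
  refine ⟨A, A, A, hA1, hA1, ?_⟩
  intro L N P I b _ hN hd hT hf hg hu hφ hgr
  have hcorrect := I.gradProc_computes b hf hg hu 0
  have htime := I.gradProc_time_le b (p := A) (by omega) hd hT (fun j hj t ht => (hφ j hj t ht).1)
    (fun i hi => (hgr i hi).1) 0
  have hspace := I.gradProc_space_le b (q := A) (by omega) (fun j hj t ht => (hφ j hj t ht).2)
    (fun i hi => (hgr i hi).2) 0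
  have hW : Programs.prodFrom (fun k => P.T k.succ) 0 *
      Programs.prodFrom (fun k => P.d k.castSucc) 0 =
      ∏ i : Fin N, P.T i.succ * P.d i.castSucc := by
    simp [Programs.prodFrom, Finset.prod_mul_distrib]
  rw [hW] at htime
  simp only [Fin.val_zero, Nat.sub_zero] at htime hspace
  set c := (I.gradProc b (Fin.last N)).time
  set s := (I.gradProc b (Fin.last N)).space
  set W := ∏ i : Fin N, P.T i.succ * P.d i.castSucc
  have hmono : ∀ {k l : ℕ}, k ≤ l → A ^ k ≤ A ^ l := fun h => Nat.pow_le_pow_right hA1.le h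
  refine ⟨hcorrect.1, hcorrect.2, ?_, ?_, ?_, ?_⟩
  · rw [nestedO_eq]
    calc _ ≤ A ^ N * (N + 1).factorial * W * c := htime
      -- The extra power is the leading factor `K` of the bound.
      _ ≤ A ^ (2 * (N + 1) - 3 + 1) * (N + 1).factorial * W * c := by
          gcongr
          · exact hA1.le
          · omega
      _ = _ := by ring
  · rw [nestedO_eq]
    exact hspace.trans (Nat.mul_le_mul le_rfl (Nat.mul_le_mul (hmono (by omega)) le_rfl))
  · calc _ ≤ A ^ N * (N + 1).factorial * W * c := htime
      _ ≤ A ^ (N + 1 + 1) * (N + 1).factorial * W * c := by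
          gcongr
          · exact hA1.le
          · omega
      _ = _ := by ring
  · calc _ ≤ b * (A ^ N * s) := hspace
      _ ≤ b * (A ^ (N + 1 + 1) * s) :=
          Nat.mul_le_mul le_rfl (Nat.mul_le_mul (hmono (by omega)) le_rfl)
      _ = _ := by ring
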